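/- **Theorem (Characterization of universal kernels).** Let $X$ be a topological space, let $\mathcal H$ be a reproducing kernel Hilbert space of real functions on $X$, and let $k:X\times X\to\mathbb R$ be its reproducing kernel. *Measures.* For Hausdorff $X$, $M_b(X)$ is the set of finite signed Radon measures, i.e. finite signed Borel measures $\mu$ whose total variation satisfies $|\mu|(B)=\sup\{|\mu|(C): C\subset B,\ C\text{ compact}\}$ for every Borel set $B$, and $M_{bc}(X)$ is the set of those with compact support. For any topological space $X$, $M_{rba}(X)$ is the set of real-valued, bounded, finitely additive set functions $\mu$ on the field $\Sigma$ generated by the closed sets of $X$ that are regular: for all $A\in\Sigma$ and $\epsilon>0$ there are $B,C\in\Sigma$ with $\overline B\subset A\subset C^\circ$ and $|\mu(D)|<\epsilon$ for every $D\in\Sigma$ with $D\subset C\setminus B$. The integral of a uniform limit of $\Sigma$-simple functions with respect to $\mu\in M_{rba}(X)$ is the limit of the integrals of these simple functions. *Universality.* - $k$ is *c-universal* if for all $g\in C(X)$ and $\epsilon>0$ there is $f\in\mathcal H$ with $\sup_X|f-g|\le\epsilon$. - $k$ is *cc-universal* if for all compact $Z\subset X$, $g\in C(Z)$ and $\epsilon>0$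 there is $f\in\mathcal H$ with $\sup_Z|f-g|\le\epsilon$. - $k$ is *$c_0$-universal* if for all $g\in C_0(X)$ and $\epsilon>0$ there is $f\in\mathcal H$ with $\sup_X|f-g|\le\epsilon$, where $C_0(X)$ is the space of continuous functions vanishing at infinity. - $k$ is *$c_b$-universal* if for all $g\in C_b(X)$ and $\epsilon>0$ there is $f\in\mathcal H$ with $\sup_X|f-g|\le\epsilon$, where $C_b(X)$ is the space of bounded continuous functions. *Embedding.* For $M$ one of the above sets of measures or set functions, the embedding $M\to\mathcal H$, $\mu\mapsto\int_X k(\cdot,x)\,d\mu(x)$, is the weak integral: every $f\in\mathcal H$ is $\mu$-integrable and $\langle f,\int_X k(\cdot,x)\,d\mu(x)\rangle_{\mathcal H}=\int_X f\,d\mu$; in particular its value at $y\in X$ is $\int_X k(y,x)\,d\mu(x)$. In each of the following cases the embedding is well defined, and: (a) If $X$ is compact Hausdorff and $k$ is continuous, then $k$ is c-universal if and only if the embedding $\mu\mapsto\int_X k(\cdot,x)\,d\mu(x)$, $\mu\in M_b(X)$, is injective. (b) If $X$ is locally compact Hausdorff and $k\in C_b(X\times X)$, then $k$ is cc-universal if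 and only if the embedding $\mu\mapsto\int_X k(\cdot,x)\,d\mu(x)$, $\mu\in M_{bc}(X)$, is injective. (c) If $X$ is locally compact Hausdorff, $k$ is bounded and $k(\cdot,x)\in C_0(X)$ for all $x\in X$, then $k$ is $c_0$-universal if and only if the embedding $\mu\mapsto\int_X k(\cdot,x)\,d\mu(x)$, $\mu\in M_b(X)$, is injective. (d) If $X$ is a normal topological space and $k$ is bounded and continuous on $X\times X$, then $k$ is $c_b$-universal if and only if the embedding $\mu\mapsto\int_X k(\cdot,x)\,d\mu(x)$, $\mu\in M_{rba}(X)$, is injective. -/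

import Mathlib

open MeasureTheory Filter Topology
open scoped BoundedContinuousFunction ZeroAtInfty RealInnerProductSpace

noncomputable section

/-! ### Reproducing kernels and notions of universality -/

namespace RKHS

section Universality

variable {X : Type*} (H : Type*) [NormedAddCommGroup H] [InnerProductSpace ℝ H] [RKHS ℝ H X ℝ]

/-- `k` is the reproducing kernel of the Hilbert space `H` of real functions on `X`, i.e. `H` is
the RKHS induced by `k`: `⟪k(·, y), k(·, x)⟫ = k(x, y)`, where `k(·, x)` represents the evaluation
at `x`. (Mathlib's `RKHS.kernel` is operator-valued; the operators on `ℝ` are identified with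
their values at `1`.) -/
def IsReproducingKernel [CompleteSpace H] (k : X → X → ℝ) : Prop :=
  ∀ x y, RKHS.kernel H x y 1 = k x y

variable [TopologicalSpace X]

/-- Every continuous function on `X` is a uniform limit of elements of `H`. -/
def IsCUniversal : Prop :=
  ∀ g : C(X, ℝ), ∀ ε > 0, ∃ f : H, ∀ x, |f x - g x| ≤ ε

/-- For each compact `Z`, every continuous function on `Z` is a uniform limit of restrictions to
`Z` of elements of `H`. -/
def IsCCUniversal : Prop :=
  ∀ Z : Set X, IsCompact Z → ∀ g : C(Z, ℝ), ∀ ε > 0, ∃ f : H, ∀ z : Z, |f z - g z| ≤ ε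

/-- Every continuous function vanishing at infinity is a uniform limit of elements of `H`. -/
def IsC0Universal : Prop :=
  ∀ g : C₀(X, ℝ), ∀ ε > 0, ∃ f : H, ∀ x, |f x - g x| ≤ ε

/-- Every bounded continuous function is a uniform limit of elements of `H`. -/
def IsCbUniversal : Prop :=
  ∀ g : X →ᵇ ℝ, ∀ ε > 0, ∃ f : H, ∀ x, |f x - g x| ≤ ε

end Universality

end RKHS

/-! ### Finite signed Radon measures -/

section SignedRadon

variable (X : Type*) [TopologicalSpace X] [MeasurableSpace X]

/-- `M_b(X)`: the finite signed measures on `X` whose total variation is inner regular with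
respect to compact sets. A `SignedMeasure` is real-valued, so its total variation is finite. -/
def SignedRadonMeasure : Type _ :=
  {μ : SignedMeasure X // μ.totalVariation.InnerRegular}

/-- `M_bc(X)`: the finite signed Radon measures with compact support. -/
def CompactSignedRadonMeasure : Type _ :=
  {μ : SignedRadonMeasure X // IsCompact μ.1.totalVariation.support}

variable {X}

/-- `f` is integrable with respect to the signed measure `μ`, and `∫ f dμ = I`. -/
def SignedRadonMeasure.HasIntegral (μ : SignedRadonMeasure X) (f : X → ℝ) (I : ℝ) : Prop :=
  μ.1.Integrable f ∧ ∫ᵛ x, f x ∂•μ.1 = I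

/-- The same for compactly supported measures. -/
def CompactSignedRadonMeasure.HasIntegral (μ : CompactSignedRadonMeasure X) (f : X → ℝ)
    (I : ℝ) : Prop :=
  SignedRadonMeasure.HasIntegral μ.1 f I

end SignedRadon

/-! ### Finitely additive regular bounded set functions -/

section SetFunctions

variable (X : Type*) [TopologicalSpace X]

/-- The field of subsets of `X` generated by the closed sets. -/
def closedField : Set (Set X) := generateSetAlgebra {F : Set X | IsClosed F}

/-- `M_rba(X)`: the real-valued, bounded, regular, finitely additive set functions on the field
generated by the closed sets. As for vector measures in Mathlib, such a set function is given the
value `0` on the subsets of `X` outside the field, so that equality is equality on the field. -/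
structure RBASetFunction extends AddContent ℝ (closedField X) where
  eq_zero_of_notMem : ∀ A ∉ closedField X, toFun A = 0
  bounded : ∃ M : ℝ, ∀ A ∈ closedField X, |toFun A| ≤ M
  regular : ∀ A ∈ closedField X, ∀ ε > 0, ∃ B ∈ closedField X, ∃ C ∈ closedField X,
    closure B ⊆ A ∧ A ⊆ interior C ∧ ∀ D ∈ closedField X, D ⊆ C \ B → |toFun D| < ε

variable {X}

/-- Simple functions over the field generated by the closed sets. -/
def IsFieldSimple (s : X → ℝ) : Prop :=
  (Set.range s).Finite ∧ ∀ c : ℝ, s ⁻¹' {c} ∈ closedField X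

namespace RBASetFunction

/-- The integral `∑ c, c * μ {s = c}` of a simple function `s`. -/
def simpleIntegral (μ : RBASetFunction X) (s : X → ℝ) : ℝ :=
  ∑ᶠ c : ℝ, c * μ.toFun (s ⁻¹' {c})

/-- `f` is integrable with respect to the bounded finitely additive set function `μ`, as a uniform
limit of simple functions, and `∫ f dμ = I`, the limit of the integrals of these functions. -/
def HasIntegral (μ : RBASetFunction X) (f : X → ℝ) (I : ℝ) : Prop :=
  ∃ s : ℕ → X → ℝ, (∀ n, IsFieldSimple (s n)) ∧ TendstoUniformly s f atTop ∧
    Tendsto (fun n => μ.simpleIntegral (s n)) atTop (𝓝 I)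

end RBASetFunction

end SetFunctions

/-! ### The embedding into the RKHS -/

/-- `Φ : M → H` is the map `μ ↦ ∫ k(·, x) dμ(x)`, where `hasInt μ f I` means that `f` is integrable
with respect to `μ` and `∫ f dμ = I`. The integral is the `H`-valued weak integral of
`x ↦ k(·, x)`, so `⟪f, Φ μ⟫ = ∫ ⟪f, k(·, x)⟫ dμ(x) = ∫ f dμ` for each `f` in `H`; its value at `y`
is the integral of `k(y, ·)`. -/
def IsKernelEmbedding {X H M : Type*} [NormedAddCommGroup H] [InnerProductSpace ℝ H]
    [RKHS ℝ H X ℝ] (k : X → X → ℝ) (hasInt : M → (X → ℝ) → ℝ → Prop) (Φ : M → H) : Prop :=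
  (∀ (μ : M) (y : X), hasInt μ (fun x => k y x) (Φ μ y)) ∧
    ∀ (μ : M) (f : H), hasInt μ (fun x => f x) ⟪f, Φ μ⟫

end

/-! Universality says that the image of `H` is dense, for the sup norm, in a space `E` of continuous
functions: `C₀(X)`, `C(Z)` with `Z` compact, or `C_b(X)`. By Hahn–Banach
(`exists_norm_sub_le_of_forall_dual`) this holds if every continuous functional on `E` that kills
`H` is zero. Such a functional is a difference of two integrals `∫ · dp - ∫ · dn` with `p`, `n`
positive. Since `⟪f, Φ μ⟫ = ∫ f dμ`, it kills `H` exactly when `Φ p = Φ n`, and injectivity of `Φ`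
then forces `p = n`. Conversely, if `Φ μ = Φ ν`, then `μ` and `ν` integrate every element of `H`
alike; density carries this over to `E`, and regularity gives `μ = ν`.

The analytic content is thus duality. A continuous functional is order bounded, hence a difference
of positive ones (`LinearMap.exists_positive_sub`). On `C₀(X)` these are represented by the
Riesz–Markov–Kakutani theorem. Functionals on `C(Z)` are pushed forward from `Z` to `X`. On `C_b(X)`
with `X` normal, a positive functional induces a content on closed sets, whose inner extension
satisfies Carathéodory's criterion on the field (`innerContent_inter_add_sdiff`); a layer
decomposition shows that it represents the functional.

The embedding itself comes from the Fréchet–Riesz theorem: `|f x| ≤ √C * ‖f‖` makes integration a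
bounded functional on `H`. -/

noncomputable section

/-! ### Jordan decomposition of order bounded functionals -/

section OrderBounded

variable {E : Type*} [AddCommGroup E] [Lattice E] [Module ℝ E]

/-- The supremum of `L` on the order interval `[0, f]`. -/
def LinearMap.supIcc (L : E →ₗ[ℝ] ℝ) (f : E) : ℝ := sSup (L '' Set.Icc 0 f)

variable {L : E →ₗ[ℝ] ℝ}

theorem LinearMap.le_supIcc (hL : ∀ f, BddAbove (L '' Set.Icc 0 f)) {f g : E} (h0 : 0 ≤ g)
    (hg : g ≤ f) : L g ≤ L.supIcc f :=
  le_csSup (hL f) ⟨g, ⟨h0, hg⟩, rfl⟩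

theorem LinearMap.supIcc_le {f : E} (hf : 0 ≤ f) {c : ℝ}
    (h : ∀ g, 0 ≤ g → g ≤ f → L g ≤ c) : L.supIcc f ≤ c :=
  csSup_le ⟨L 0, 0, ⟨le_rfl, hf⟩, rfl⟩ (by rintro _ ⟨g, hg, rfl⟩; exact h g hg.1 hg.2)

theorem LinearMap.supIcc_nonneg (hL : ∀ f, BddAbove (L '' Set.Icc 0 f)) {f : E} (hf : 0 ≤ f) :
    0 ≤ L.supIcc f := by
  simpa using L.le_supIcc hL le_rfl hf

theorem LinearMap.supIcc_smul [PosSMulMono ℝ E] (hL : ∀ f, BddAbove (L '' Set.Icc 0 f)) {f : E}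
    (hf : 0 ≤ f) {c : ℝ} (hc : 0 < c) : L.supIcc (c • f) = c * L.supIcc f := by
  have key : ∀ {f : E}, 0 ≤ f → ∀ {c : ℝ}, 0 < c → c * L.supIcc f ≤ L.supIcc (c • f) := by
    intro f hf c hc
    rw [← le_div_iff₀' hc]
    refine L.supIcc_le hf fun g g0 hg => ?_
    rw [le_div_iff₀' hc]
    simpa using L.le_supIcc hL (smul_nonneg hc.le g0) (smul_le_smul_of_nonneg_left hg hc.le)
  refine le_antisymm ?_ (key hf hc)
  have := key (smul_nonneg hc.le hf) (inv_pos.2 hc)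
  rwa [smul_smul, inv_mul_cancel₀ hc.ne', one_smul, inv_mul_le_iff₀ hc] at this

variable [IsOrderedAddMonoid E]

/-- Riesz decomposition: an element `h` of `[0, f + g]` splits as `h ⊓ f`, in `[0, f]`, plus `h - h
⊓ f`, in `[0, g]`. -/
theorem LinearMap.supIcc_add (hL : ∀ f, BddAbove (L '' Set.Icc 0 f)) {f g : E} (hf : 0 ≤ f)
    (hg : 0 ≤ g) : L.supIcc (f + g) = L.supIcc f + L.supIcc g := by
  apply le_antisymm
  · refine L.supIcc_le (add_nonneg hf hg) fun h h0 hh => ?_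
    have h1 : L (h ⊓ f) ≤ L.supIcc f := L.le_supIcc hL (le_inf h0 hf) inf_le_right
    have h2 : L (h - h ⊓ f) ≤ L.supIcc g := by
      refine L.le_supIcc hL (sub_nonneg.2 inf_le_left) ?_
      rw [sub_le_comm]
      exact le_inf (sub_le_self _ hg) (by rwa [sub_le_iff_le_add])
    rw [map_sub] at h2
    linarith
  · rw [← le_sub_iff_add_le]
    refine L.supIcc_le hf fun a a0 ha => ?_
    rw [le_sub_comm]
    refine L.supIcc_le hg fun b b0 hb => ?_
    have := L.le_supIcc hL (add_nonneg a0 b0) (add_le_add ha hb)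
    rw [map_add] at this
    linarith

/-- An order bounded linear functional on a vector lattice is a difference of positive ones, the
first of which is the supremum over order intervals. -/
theorem LinearMap.exists_positive_sub [PosSMulMono ℝ E]
    (hL : ∀ f, BddAbove (L '' Set.Icc 0 f)) :
    ∃ P N : E →ₚ[ℝ] ℝ, (∀ f, L f = P f - N f) ∧ ∀ f, 0 ≤ f → P f = L.supIcc f := by
  -- Additivity on the positive cone makes the difference of the values depend only on `a - b`.
  -- Linearity of `P₀` may therefore be checked on any convenient decomposition into nonnegative
  -- elements.
  have ext : ∀ a b c d : E, 0 ≤ a → 0 ≤ b → 0 ≤ c → 0 ≤ d → a - b = c - d →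
      L.supIcc a - L.supIcc b = L.supIcc c - L.supIcc d := by
    intro a b c d ha hb hc hd h
    have : a + d = c + b := by rw [← sub_eq_sub_iff_add_eq_add, h]
    have := congrArg L.supIcc this
    rw [supIcc_add hL ha hd, supIcc_add hL hc hb] at this
    linarith
  let P₀ : E →ₗ[ℝ] ℝ :=
    { toFun := fun f => L.supIcc f⁺ - L.supIcc f⁻
      map_add' := fun f g => by
        rw [ext (f + g)⁺ (f + g)⁻ (f⁺ + g⁺) (f⁻ + g⁻) (posPart_nonneg _) (negPart_nonneg _)
          (add_nonneg (posPart_nonneg _) (posPart_nonneg _))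
          (add_nonneg (negPart_nonneg _) (negPart_nonneg _)),
          supIcc_add hL (posPart_nonneg _) (posPart_nonneg _),
          supIcc_add hL (negPart_nonneg _) (negPart_nonneg _)]
        · ring
        · rw [posPart_sub_negPart, add_sub_add_comm, posPart_sub_negPart, posPart_sub_negPart]
      map_smul' := fun c f => by
        rcases lt_trichotomy c 0 with hc | rfl | hc
        -- A negative scalar exchanges the roles of `f⁺` and `f⁻`.
        · have hc' : 0 < -c := neg_pos.2 hc
          rw [ext (c • f)⁺ (c • f)⁻ ((-c) • f⁻) ((-c) • f⁺) (posPart_nonneg _) (negPart_nonneg _)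
            (smul_nonneg hc'.le (negPart_nonneg _)) (smul_nonneg hc'.le (posPart_nonneg _)),
            supIcc_smul hL (negPart_nonneg _) hc', supIcc_smul hL (posPart_nonneg _) hc']
          · simp only [RingHom.id_apply, smul_eq_mul]; ring
          · rw [posPart_sub_negPart, ← smul_sub, ← neg_sub f⁺, posPart_sub_negPart, smul_neg,
              neg_smul, neg_neg]
        · simp
        · rw [ext (c • f)⁺ (c • f)⁻ (c • f⁺) (c • f⁻) (posPart_nonneg _) (negPart_nonneg _)
            (smul_nonneg hc.le (posPart_nonneg _)) (smul_nonneg hc.le (negPart_nonneg _)),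
            supIcc_smul hL (negPart_nonneg _) hc, supIcc_smul hL (posPart_nonneg _) hc]
          · simp only [RingHom.id_apply, smul_eq_mul]; ring
          · rw [posPart_sub_negPart, ← smul_sub, posPart_sub_negPart] }
  have hP : ∀ f, 0 ≤ f → P₀ f = L.supIcc f := fun f hf => by
    have h0 : L.supIcc (0 : E) = 0 := by
      simp [LinearMap.supIcc]
    change L.supIcc f⁺ - L.supIcc f⁻ = _
    rw [posPart_of_nonneg hf, negPart_of_nonneg hf, h0, sub_zero]
  refine ⟨.mk₀ P₀ fun f hf => by rw [hP f hf]; exact supIcc_nonneg hL hf,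
    .mk₀ (P₀ - L) fun f hf => ?_, fun f => ?_, hP⟩
  -- `N = P₀ - L` is positive because `f` itself lies in `[0, f]`.
  · rw [LinearMap.sub_apply, hP f hf, sub_nonneg]
    exact L.le_supIcc hL hf le_rfl
  · change L f = P₀ f - (P₀ f - L f)
    ring

end OrderBounded

/-! ### The dual of `C₀(X)` and finite signed Radon measures -/

section DualC0

open scoped CompactlySupported

variable {X : Type*} [TopologicalSpace X]

theorem ZeroAtInftyContinuousMap.integrable [MeasurableSpace X] [BorelSpace X] (f : C₀(X, ℝ))
    (μ : Measure X) [IsFiniteMeasure μ] : Integrable (fun x => f x) μ :=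
  f.toBCF.integrable μ

variable [T2Space X]

/-- Soft thresholding: a function vanishing at infinity is uniformly close to compactly supported
continuous ones. -/
theorem ZeroAtInftyContinuousMap.exists_compactlySupported_abs_sub_le (f : C₀(X, ℝ)) {ε : ℝ}
    (hε : 0 < ε) : ∃ g : C_c(X, ℝ), ∀ x, |f x - g x| ≤ ε := by
  have h0 : ∀ᶠ x in cocompact X, |f x| < ε := by
    have := (zero_at_infty f).abs
    rw [abs_zero] at this
    exact this.eventually_lt_const hε
  obtain ⟨K, hK, hKf⟩ := mem_cocompact.1 h0
  have hcont : Continuous fun x => f x - max (-ε) (min (f x) ε) := by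
    have := f.continuous
    fun_prop
  have hcl : IsClosed {x | ε ≤ |f x|} := isClosed_le continuous_const f.continuous.abs
  have hsub : {x | ε ≤ |f x|} ⊆ K := fun x hx => by
    by_contra hxK
    exact absurd (show |f x| < ε from hKf hxK) (not_lt.2 hx)
  refine ⟨⟨⟨_, hcont⟩, HasCompactSupport.of_support_subset_isCompact
    (hK.of_isClosed_subset hcl hsub) fun x hx => ?_⟩, fun x => ?_⟩
  · by_contra hlt
    rw [Set.mem_ofPred_eq, not_le, abs_lt] at hlt
    refine hx ?_
    simp [min_eq_left hlt.2.le, max_eq_right hlt.1.le]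
  · change |f x - (f x - max (-ε) (min (f x) ε))| ≤ ε
    rw [sub_sub_cancel, abs_le]
    exact ⟨le_max_left _ _, max_le (by linarith) (min_le_right _ _)⟩

variable [MeasurableSpace X] [BorelSpace X]

variable [LocallyCompactSpace X]

/-- The mass of a compact set is at most `P g` for a Urysohn function `g` equal to `1` on it, and
inner regularity of the whole space passes the bound `C` to the total mass. -/
theorem RealRMK.isFiniteMeasure_rieszMeasure (P : C_c(X, ℝ) →ₚ[ℝ] ℝ) {C : ℝ}
    (hC : ∀ f : C_c(X, ℝ), (∀ x, 0 ≤ f x) → (∀ x, f x ≤ 1) → P f ≤ C) :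
    IsFiniteMeasure (RealRMK.rieszMeasure P) := by
  refine ⟨lt_of_le_of_lt ?_ (ENNReal.ofReal_lt_top (r := C))⟩
  rw [isOpen_univ.measure_eq_iSup_isCompact]
  refine iSup₂_le fun K _ => iSup_le fun hK => ?_
  obtain ⟨f, hf1, hf2, -, hf3⟩ :=
    exists_continuousMap_one_of_isCompact_subset_isOpen hK isOpen_univ (Set.subset_univ K)
  let g : C_c(X, ℝ) := ⟨f, hasCompactSupport_def.mpr hf2⟩
  exact (RealRMK.rieszMeasure_le_of_eq_one P (f := g) (fun x => (hf3 x).1) hK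
    fun x hx => hf1 hx).trans
    (ENNReal.ofReal_le_ofReal (hC g (fun x => (hf3 x).1) fun x => (hf3 x).2))

/-- A continuous linear functional on `C₀(X)` is the difference of the integrals with respect to
two finite regular measures. -/
theorem ZeroAtInftyContinuousMap.exists_measure_dual (Λ : C₀(X, ℝ) →L[ℝ] ℝ) :
    ∃ p n : Measure X, IsFiniteMeasure p ∧ IsFiniteMeasure n ∧ p.Regular ∧ n.Regular ∧
      ∀ f : C₀(X, ℝ), Λ f = ∫ x, f x ∂p - ∫ x, f x ∂n := by
  let ι : C_c(X, ℝ) →ₗ[ℝ] C₀(X, ℝ) :=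
    { toFun := fun f => f
      map_add' := fun f g => rfl
      map_smul' := fun c f => rfl }
  have hι : ∀ f x, ι f x = f x := fun f x => rfl
  let L : C_c(X, ℝ) →ₗ[ℝ] ℝ := Λ.toLinearMap ∘ₗ ι
  have hLb : ∀ (f : C_c(X, ℝ)) {c : ℝ}, 0 ≤ c → (∀ x, |f x| ≤ c) → |L f| ≤ ‖Λ‖ * c := by
    intro f c hc hf
    refine (Λ.le_opNorm (ι f)).trans (mul_le_mul_of_nonneg_left ?_ (norm_nonneg _))
    rw [← ZeroAtInftyContinuousMap.norm_toBCF_eq_norm, BoundedContinuousFunction.norm_le hc]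
    exact hf
  have hLb' : ∀ (f g : C_c(X, ℝ)) {c : ℝ}, 0 ≤ c → (∀ x, f x ≤ c) → 0 ≤ g → g ≤ f →
      |L g| ≤ ‖Λ‖ * c := by
    intro f g c hc hf h0 hg
    refine hLb g hc fun x => ?_
    rw [abs_of_nonneg (h0 x)]
    exact (hg x).trans (hf x)
  have hmono : PosSMulMono ℝ C_c(X, ℝ) :=
    ⟨fun c hc f g hfg x => mul_le_mul_of_nonneg_left (hfg x) hc⟩
  have hbdd : ∀ f : C_c(X, ℝ), BddAbove (L '' Set.Icc 0 f) := by
    intro f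
    refine ⟨‖Λ‖ * ‖ι f‖, ?_⟩
    rintro _ ⟨g, hg, rfl⟩
    exact (le_abs_self _).trans (hLb' f g (norm_nonneg _) (fun x => (le_abs_self _).trans
      ((ι f).toBCF.norm_coe_le_norm x)) hg.1 hg.2)
  obtain ⟨P, N, hPN, hP⟩ := L.exists_positive_sub hbdd
  have hPC : ∀ f : C_c(X, ℝ), (∀ x, 0 ≤ f x) → (∀ x, f x ≤ 1) → P f ≤ ‖Λ‖ := by
    intro f h0 h1
    rw [hP f h0]
    refine L.supIcc_le h0 fun g g0 hg => ?_
    simpa using (le_abs_self _).trans (hLb' f g zero_le_one h1 g0 hg)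
  -- `N = P - L`, so the bounds for `P` and `L` add up.
  have hNC : ∀ f : C_c(X, ℝ), (∀ x, 0 ≤ f x) → (∀ x, f x ≤ 1) → N f ≤ ‖Λ‖ + ‖Λ‖ := by
    intro f h0 h1
    have h2 := hLb' f f zero_le_one h1 h0 le_rfl
    rw [hPN, mul_one] at h2
    linarith [hPC f h0 h1, (abs_le.1 h2).1]
  have hp := RealRMK.isFiniteMeasure_rieszMeasure P hPC
  have hn := RealRMK.isFiniteMeasure_rieszMeasure N hNC
  refine ⟨RealRMK.rieszMeasure P, RealRMK.rieszMeasure N, hp, hn, inferInstance, inferInstance,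
    fun f => ?_⟩
  set p := RealRMK.rieszMeasure P
  set n := RealRMK.rieszMeasure N
  have hc : ∀ g : C_c(X, ℝ), Λ (ι g) = ∫ x, ι g x ∂p - ∫ x, ι g x ∂n := by
    intro g
    simp only [hι]
    rw [RealRMK.integral_rieszMeasure, RealRMK.integral_rieszMeasure]
    exact hPN g
  have hint : ∀ (m : Measure X) [IsFiniteMeasure m] (g : C_c(X, ℝ)) {ε : ℝ},
      (∀ x, |f x - g x| ≤ ε) → |∫ x, f x ∂m - ∫ x, ι g x ∂m| ≤ ε * m.real Set.univ := by
    intro m _ g ε hg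
    rw [← integral_sub (f.integrable m) ((ι g).integrable m)]
    exact norm_integral_le_of_norm_le_const (f := fun x => f x - ι g x) (ae_of_all _ hg)
  rw [← sub_eq_zero, ← abs_nonpos_iff]
  refine le_of_forall_pos_le_add fun δ hδ => ?_
  -- Both sides are Lipschitz in the sup norm, with constants adding up to `C`, so the identity
  -- extends from compactly supported functions; `C + 1` avoids a zero denominator.
  set C := ‖Λ‖ + p.real Set.univ + n.real Set.univ with hC
  have hC0 : 0 ≤ C := by positivity
  obtain ⟨g, hg⟩ := f.exists_compactlySupported_abs_sub_le (ε := δ / (C + 1)) (by positivity)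
  have h1 := hint p g hg
  have h2 := hint n g hg
  have h3 : |Λ f - Λ (ι g)| ≤ ‖Λ‖ * (δ / (C + 1)) := by
    rw [← map_sub]
    refine (Λ.le_opNorm _).trans (mul_le_mul_of_nonneg_left ?_ (norm_nonneg _))
    rw [← ZeroAtInftyContinuousMap.norm_toBCF_eq_norm,
      BoundedContinuousFunction.norm_le (by positivity)]
    exact hg
  have h4 : C * (δ / (C + 1)) ≤ δ := by
    rw [mul_div_assoc', div_le_iff₀ (by positivity)]
    nlinarith
  rw [hc g] at h3
  rw [abs_le] at h1 h2 h3 ⊢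
  rw [hC] at h4
  constructor <;> nlinarith [h1.1, h1.2, h2.1, h2.2, h3.1, h3.2]

end DualC0

/-! ### Integrals with respect to signed measures. -/

section SignedIntegral

variable {X : Type*} [MeasurableSpace X]

namespace MeasureTheory.SignedMeasure

theorem integrable_posPart {μ : SignedMeasure X} {f : X → ℝ} (hf : μ.Integrable f) :
    Integrable f μ.toJordanDecomposition.posPart := by
  rw [VectorMeasure.Integrable, ← totalVariation_eq_variation] at hf
  exact hf.mono_measure (Measure.le_add_right le_rfl)

theorem integrable_negPart {μ : SignedMeasure X} {f : X → ℝ} (hf : μ.Integrable f) :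
    Integrable f μ.toJordanDecomposition.negPart := by
  rw [VectorMeasure.Integrable, ← totalVariation_eq_variation] at hf
  exact hf.mono_measure (Measure.le_add_left le_rfl)

end MeasureTheory.SignedMeasure

theorem MeasureTheory.Measure.integral_toSignedMeasure_real (m : Measure X) [IsFiniteMeasure m]
    (f : X → ℝ) : ∫ᵛ x, f x ∂•m.toSignedMeasure = ∫ x, f x ∂m := by
  rw [← VectorMeasure.integral_toSignedMeasure]
  congr 1
  ext
  simp

theorem MeasureTheory.SignedMeasure.integral_eq_sub {μ : SignedMeasure X} {f : X → ℝ}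
    (hf : μ.Integrable f) : ∫ᵛ x, f x ∂•μ = ∫ x, f x ∂μ.toJordanDecomposition.posPart -
      ∫ x, f x ∂μ.toJordanDecomposition.negPart := by
  have h : μ = μ.toJordanDecomposition.posPart.toSignedMeasure -
      μ.toJordanDecomposition.negPart.toSignedMeasure :=
    μ.toSignedMeasure_toJordanDecomposition.symm
  conv_lhs => rw [h]
  rw [VectorMeasure.integral_sub_vectorMeasure, Measure.integral_toSignedMeasure_real,
    Measure.integral_toSignedMeasure_real]
  · simpa [VectorMeasure.Integrable] using integrable_posPart hf
  · simpa [VectorMeasure.Integrable] using integrable_negPart hf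

namespace MeasureTheory.SignedMeasure

/-- An almost everywhere bound is enough, so that for compactly supported measures an approximation
on the support can be used. -/
theorem abs_integral_sub_le {μ : SignedMeasure X} {f g : X → ℝ} (hf : μ.Integrable f)
    (hg : μ.Integrable g) {ε : ℝ} (h : ∀ᵐ x ∂μ.totalVariation, |f x - g x| ≤ ε) :
    |∫ᵛ x, f x ∂•μ - ∫ᵛ x, g x ∂•μ| ≤ ε * μ.totalVariation.real Set.univ := by
  have hfin : IsFiniteMeasure μ.variation := by
    rw [← totalVariation_eq_variation]; infer_instance
  rw [totalVariation_eq_variation] at h ⊢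
  rw [← VectorMeasure.integral_fun_sub hf hg]
  have h1 := VectorMeasure.norm_integral_le_of_norm_le_const (μ := μ)
    (B := ContinuousLinearMap.lsmul ℝ ℝ) (f := fun x => f x - g x) (C := ε) h
  rwa [ContinuousLinearMap.opNorm_lsmul, mul_one, Real.norm_eq_abs] at h1

end MeasureTheory.SignedMeasure

end SignedIntegral

/-! ### Signed Radon measures are determined by their integrals. -/

section RadonUniqueness

open scoped CompactlySupported

variable {X : Type*} [TopologicalSpace X] [MeasurableSpace X]

/-- A compact `K ⊆ A` with `τ (A \ K) < m A - r` also has `m (A \ K) < m A - r`, hence `m K > r`.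
This makes the Jordan parts of a signed Radon measure inner regular. -/
theorem MeasureTheory.Measure.InnerRegular.of_le [OpensMeasurableSpace X] [T2Space X]
    {m τ : Measure X} [IsFiniteMeasure τ] [τ.InnerRegular] (h : m ≤ τ) : m.InnerRegular := by
  have : IsFiniteMeasure m := isFiniteMeasure_of_le τ h
  refine ⟨fun A hA r hr => ?_⟩
  obtain ⟨K, hKA, hK, hlt⟩ :=
    hA.exists_isCompact_sdiff_lt (measure_ne_top τ A) (tsub_pos_of_lt hr).ne'
  refine ⟨K, hKA, hK, ?_⟩
  by_contra! hle
  have h1 : m A ≤ m K + m (A \ K) := by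
    rw [← measure_union Set.disjoint_sdiff_right (hA.diff hK.measurableSet),
      Set.union_sdiff_cancel hKA]
  have h2 : m A < r + (m A - r) := by
    refine (h1.trans (add_le_add hle (h _))).trans_lt ?_
    exact (ENNReal.add_lt_add_iff_left hr.ne_top).2 hlt
  rw [add_tsub_cancel_of_le hr.le] at h2
  exact h2.false

namespace MeasureTheory.SignedMeasure

theorem integrable_of_continuous_of_abs_le [OpensMeasurableSpace X] (μ : SignedMeasure X)
    {f : X → ℝ} (hf : Continuous f) {C : ℝ} (hC : ∀ x, |f x| ≤ C) : μ.Integrable f := by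
  rw [VectorMeasure.Integrable, ← totalVariation_eq_variation]
  exact Integrable.of_bound hf.aestronglyMeasurable C (ae_of_all _ hC)

variable [BorelSpace X] [LocallyCompactSpace X] [T2Space X]

/-- Signed Radon measures with the same integrals of compactly supported functions are equal. -/
theorem ext_of_integral_eq {μ ν : SignedMeasure X} (hμ : μ.totalVariation.InnerRegular)
    (hν : ν.totalVariation.InnerRegular)
    (h : ∀ g : C_c(X, ℝ), ∫ᵛ x, g x ∂•μ = ∫ᵛ x, g x ∂•ν) : μ = ν := by
  have hle : ∀ σ : SignedMeasure X, σ.toJordanDecomposition.posPart ≤ σ.totalVariation ∧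
      σ.toJordanDecomposition.negPart ≤ σ.totalVariation := fun σ =>
    ⟨Measure.le_add_right le_rfl, Measure.le_add_left le_rfl⟩
  have h1 := Measure.InnerRegular.of_le (hle μ).1
  have h2 := Measure.InnerRegular.of_le (hle μ).2
  have h3 := Measure.InnerRegular.of_le (hle ν).1
  have h4 := Measure.InnerRegular.of_le (hle ν).2
  -- Moving the negative parts across leaves an identity of positive measures, to which Riesz–Markov
  -- uniqueness applies.
  have key : μ.toJordanDecomposition.posPart + ν.toJordanDecomposition.negPart =
      ν.toJordanDecomposition.posPart + μ.toJordanDecomposition.negPart := by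
    refine Measure.ext_of_integral_eq_on_compactlySupported fun g => ?_
    have hi : ∀ m : Measure X, [IsFiniteMeasure m] → Integrable (fun x => g x) m := fun m _ =>
      g.integrable
    obtain ⟨C, hC⟩ := g.hasCompactSupport.exists_bound_of_continuous g.continuous
    have hgc : Continuous fun x => g x := g.continuous
    have hg := h g
    rw [integral_eq_sub (μ.integrable_of_continuous_of_abs_le hgc hC),
      integral_eq_sub (ν.integrable_of_continuous_of_abs_le hgc hC)] at hg
    rw [integral_add_measure (hi _) (hi _), integral_add_measure (hi _) (hi _)]
    linarith
  ext A hA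
  have hkA := congrArg (Measure.real · A) key
  beta_reduce at hkA
  rw [measureReal_add_apply, measureReal_add_apply] at hkA
  rw [μ.apply_eq_posPart_real_sub_negPart_real hA, ν.apply_eq_posPart_real_sub_negPart_real hA]
  linarith

/-- Signed Radon measures are equal if they have the same integral for sufficiently many functions
to approximate the compactly supported ones. -/
theorem ext_of_forall_exists_approx {μ ν : SignedMeasure X} (hμ : μ.totalVariation.InnerRegular)
    (hν : ν.totalVariation.InnerRegular)
    (h : ∀ g : C_c(X, ℝ), ∀ ε > 0, ∃ f : X → ℝ, μ.Integrable f ∧ ν.Integrable f ∧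
      ∫ᵛ x, f x ∂•μ = ∫ᵛ x, f x ∂•ν ∧ (∀ᵐ x ∂μ.totalVariation, |f x - g x| ≤ ε) ∧
      ∀ᵐ x ∂ν.totalVariation, |f x - g x| ≤ ε) : μ = ν := by
  refine ext_of_integral_eq hμ hν fun g => ?_
  obtain ⟨C, hC⟩ := g.hasCompactSupport.exists_bound_of_continuous g.continuous
  have hgc : Continuous fun x => g x := g.continuous
  rw [← sub_eq_zero, ← abs_nonpos_iff]
  refine le_of_forall_pos_le_add fun δ hδ => ?_
  set T := μ.totalVariation.real Set.univ + ν.totalVariation.real Set.univ with hT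
  have hT0 : 0 ≤ T := by positivity
  obtain ⟨f, hfμ, hfν, hf, h1, h2⟩ := h g (δ / (T + 1)) (by positivity)
  have h3 := abs_integral_sub_le hfμ (μ.integrable_of_continuous_of_abs_le hgc hC) h1
  have h4 := abs_integral_sub_le hfν (ν.integrable_of_continuous_of_abs_le hgc hC) h2
  have h5 : T * (δ / (T + 1)) ≤ δ := by
    rw [mul_div_assoc', div_le_iff₀ (by positivity)]
    nlinarith
  rw [hT] at h5
  rw [abs_le] at h3 h4 ⊢
  constructor <;> nlinarith [h3.1, h3.2, h4.1, h4.2]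

end MeasureTheory.SignedMeasure

end RadonUniqueness

/-! ### Integration with respect to finitely additive set functions -/

section FieldIntegral

variable {X : Type*} [TopologicalSpace X]

theorem isSetAlgebra_closedField : IsSetAlgebra (closedField X) :=
  isSetAlgebra_generateSetAlgebra

theorem IsClosed.mem_closedField {F : Set X} (hF : IsClosed F) : F ∈ closedField X :=
  self_subset_generateSetAlgebra hF

theorem IsOpen.mem_closedField {U : Set X} (hU : IsOpen U) : U ∈ closedField X := by
  simpa using isSetAlgebra_closedField.compl_mem hU.isClosed_compl.mem_closedField

theorem IsFieldSimple.prodMk_preimage_mem {s t : X → ℝ} (hs : IsFieldSimple s)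
    (ht : IsFieldSimple t) (c : ℝ × ℝ) : (fun x => (s x, t x)) ⁻¹' {c} ∈ closedField X := by
  have : (fun x => (s x, t x)) ⁻¹' {c} = s ⁻¹' {c.1} ∩ t ⁻¹' {c.2} := by
    ext x; simp [Prod.ext_iff]
  rw [this]
  exact isSetAlgebra_closedField.inter_mem (hs.2 _) (ht.2 _)

theorem IsFieldSimple.finite_range_prodMk {s t : X → ℝ} (hs : IsFieldSimple s)
    (ht : IsFieldSimple t) : (Set.range fun x => (s x, t x)).Finite :=
  (hs.1.prod ht.1).subset (by rintro _ ⟨x, rfl⟩; exact ⟨⟨x, rfl⟩, ⟨x, rfl⟩⟩)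

/-- Functions that factor through a finite partition into members of the field are simple. -/
theorem IsFieldSimple.of_comp {ι : Type*} {π : X → ι} (hπ : (Set.range π).Finite)
    (hm : ∀ i, π ⁻¹' {i} ∈ closedField X) (φ : ι → ℝ) : IsFieldSimple (φ ∘ π) := by
  classical
  refine ⟨by rw [Set.range_comp]; exact hπ.image φ, fun c => ?_⟩
  have : φ ∘ π ⁻¹' {c} = ⋃ i ∈ hπ.toFinset.filter (φ · = c), π ⁻¹' {i} := by
    ext x; simp
  rw [this]
  exact isSetAlgebra_closedField.biUnion_mem _ fun i _ => hm i

theorem IsFieldSimple.comp₂ {s t : X → ℝ} (hs : IsFieldSimple s) (ht : IsFieldSimple t)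
    (φ : ℝ × ℝ → ℝ) : IsFieldSimple fun x => φ (s x, t x) :=
  .of_comp (hs.finite_range_prodMk ht) (hs.prodMk_preimage_mem ht) φ

theorem IsFieldSimple.indicator_one {A : Set X} (hA : A ∈ closedField X) :
    IsFieldSimple (A.indicator 1 : X → ℝ) := by
  classical
  refine ⟨(Set.toFinite {0, 1}).subset ?_, fun c => ?_⟩
  · rintro _ ⟨x, rfl⟩
    by_cases hx : x ∈ A <;> simp [hx]
  · by_cases h0 : c = 0
    · convert isSetAlgebra_closedField.compl_mem hA using 1
      ext x
      by_cases hx : x ∈ A <;> simp [hx, h0]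
    · by_cases h1 : c = 1
      · convert hA using 1
        ext x
        by_cases hx : x ∈ A <;> simp [hx, h1]
      · convert isSetAlgebra_closedField.empty_mem using 1
        ext x
        by_cases hx : x ∈ A <;> simp [hx, Ne.symm h0, Ne.symm h1]

namespace RBASetFunction

variable (μ : RBASetFunction X)

theorem toFun_biUnion {ι : Type*} (S : Finset ι) {A : ι → Set X}
    (hA : ∀ i ∈ S, A i ∈ closedField X) (hd : (S : Set ι).PairwiseDisjoint A) :
    μ.toFun (⋃ i ∈ S, A i) = ∑ i ∈ S, μ.toFun (A i) :=
  addContent_biUnion (m := μ.toAddContent) hA hd (isSetAlgebra_closedField.biUnion_mem S hA)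

theorem toFun_empty : μ.toFun ∅ = 0 := μ.empty'

/-- The integral of a simple function may be computed on any finite partition on whose members
it is constant. -/
theorem simpleIntegral_comp {ι : Type*} {π : X → ι} (hπ : (Set.range π).Finite)
    (hm : ∀ i, π ⁻¹' {i} ∈ closedField X) (φ : ι → ℝ) :
    μ.simpleIntegral (φ ∘ π) = ∑ i ∈ hπ.toFinset, φ i * μ.toFun (π ⁻¹' {i}) := by
  classical
  -- A level set of `φ ∘ π` is a finite disjoint union of fibres of `π`; the sum is then regrouped
  -- by the values of `φ`.
  have hfib : ∀ c, μ.toFun (φ ∘ π ⁻¹' {c}) =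
      ∑ i ∈ hπ.toFinset.filter (φ · = c), μ.toFun (π ⁻¹' {i}) := by
    intro c
    have : φ ∘ π ⁻¹' {c} = ⋃ i ∈ hπ.toFinset.filter (φ · = c), π ⁻¹' {i} := by
      ext x; simp
    rw [this]
    refine μ.toFun_biUnion _ (fun i _ => hm i) fun i _ j _ hij => ?_
    exact Disjoint.preimage π (by simpa using hij)
  rw [simpleIntegral, finsum_eq_sum_of_support_subset (s := hπ.toFinset.image φ)]
  · rw [← Finset.sum_fiberwise_of_maps_to (t := hπ.toFinset.image φ) (g := φ)
      fun i hi => Finset.mem_image_of_mem φ hi]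
    refine Finset.sum_congr rfl fun c _ => ?_
    rw [hfib, Finset.mul_sum]
    refine Finset.sum_congr rfl fun i hi => ?_
    rw [(Finset.mem_filter.1 hi).2]
  · intro c hc
    by_contra hcn
    refine hc ?_
    change c * μ.toFun _ = 0
    rw [hfib, Finset.filter_eq_empty_iff.2, Finset.sum_empty, mul_zero]
    intro i hi h
    exact hcn (Finset.mem_coe.2 (Finset.mem_image.2 ⟨i, hi, h⟩))

/-- The level sets of the pair `(s, t)` form a common refinement of both partitions, on which sums
and differences are computed termwise. -/
theorem simpleIntegral_comp₂ {s t : X → ℝ} (hs : IsFieldSimple s) (ht : IsFieldSimple t)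
    (φ : ℝ × ℝ → ℝ) : μ.simpleIntegral (fun x => φ (s x, t x)) =
      ∑ c ∈ (hs.finite_range_prodMk ht).toFinset,
        φ c * μ.toFun ((fun x => (s x, t x)) ⁻¹' {c}) :=
  μ.simpleIntegral_comp (hs.finite_range_prodMk ht) (hs.prodMk_preimage_mem ht) φ

theorem simpleIntegral_add {s t : X → ℝ} (hs : IsFieldSimple s) (ht : IsFieldSimple t) :
    μ.simpleIntegral (fun x => s x + t x) = μ.simpleIntegral s + μ.simpleIntegral t := by
  have h1 := μ.simpleIntegral_comp₂ hs ht fun c => c.1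
  have h2 := μ.simpleIntegral_comp₂ hs ht fun c => c.2
  have h3 := μ.simpleIntegral_comp₂ hs ht fun c => c.1 + c.2
  refine h3.trans ?_
  simp only [add_mul, Finset.sum_add_distrib]
  exact congrArg₂ _ h1.symm h2.symm

theorem simpleIntegral_sub {s t : X → ℝ} (hs : IsFieldSimple s) (ht : IsFieldSimple t) :
    μ.simpleIntegral (fun x => s x - t x) = μ.simpleIntegral s - μ.simpleIntegral t := by
  have h1 := μ.simpleIntegral_comp₂ hs ht fun c => c.1
  have h2 := μ.simpleIntegral_comp₂ hs ht fun c => c.2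
  have h3 := μ.simpleIntegral_comp₂ hs ht fun c => c.1 - c.2
  refine h3.trans ?_
  simp only [sub_mul, Finset.sum_sub_distrib]
  exact congrArg₂ _ h1.symm h2.symm

theorem simpleIntegral_const_mul {s : X → ℝ} (hs : IsFieldSimple s) (a : ℝ) :
    μ.simpleIntegral (fun x => a * s x) = a * μ.simpleIntegral s := by
  have h1 := μ.simpleIntegral_comp hs.1 hs.2 id
  have h2 := μ.simpleIntegral_comp hs.1 hs.2 (a * ·)
  refine h2.trans ?_
  rw [show μ.simpleIntegral s = μ.simpleIntegral (id ∘ s) from rfl, h1, Finset.mul_sum]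
  exact Finset.sum_congr rfl fun c _ => mul_assoc _ _ _

theorem simpleIntegral_indicator_one (A : Set X) :
    μ.simpleIntegral (A.indicator 1) = μ.toFun A := by
  rw [simpleIntegral, finsum_eq_single _ 1]
  · rw [one_mul]
    congr 1
    ext x
    by_cases hx : x ∈ A <;> simp [hx]
  · intro c hc
    by_cases h0 : c = 0
    · simp [h0]
    · have : (A.indicator 1 : X → ℝ) ⁻¹' {c} = ∅ := by
        ext x
        by_cases hx : x ∈ A <;> simp [hx, Ne.symm h0, Ne.symm hc]
      rw [this, toFun_empty, mul_zero]

/-- The total variation of `μ` on a set is at most twice the supremum of `|μ|`. -/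
theorem sum_abs_toFun_le {ι : Type*} (S : Finset ι) {A : ι → Set X} {E : Set X} {M : ℝ}
    (hM : ∀ D ∈ closedField X, D ⊆ E → |μ.toFun D| ≤ M) (hA : ∀ i ∈ S, A i ∈ closedField X)
    (hE : ∀ i ∈ S, A i ⊆ E) (hd : (S : Set ι).PairwiseDisjoint A) :
    ∑ i ∈ S, |μ.toFun (A i)| ≤ 2 * M := by
  classical
  have key : ∀ T ⊆ S, |∑ i ∈ T, μ.toFun (A i)| ≤ M := by
    intro T hT
    rw [← μ.toFun_biUnion T (fun i hi => hA i (hT hi)) (hd.subset (Finset.coe_subset.2 hT))]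
    exact hM _ (isSetAlgebra_closedField.biUnion_mem T fun i hi => hA i (hT hi))
      (Set.iUnion₂_subset fun i hi => hE i (hT hi))
  -- The sum of absolute values over the indices of one sign is the absolute value of `μ` on a
  -- union, at most `M`; the two signs give the factor `2`.
  rw [← Finset.sum_filter_add_sum_filter_not S fun i => 0 ≤ μ.toFun (A i), two_mul]
  refine add_le_add ((le_of_eq ?_).trans ((le_abs_self _).trans (key (S.filter fun i => 0 ≤ μ.toFun (A i)) (Finset.filter_subset _ S))))
    ((le_of_eq ?_).trans ((neg_le_abs _).trans (key (S.filter fun i => ¬0 ≤ μ.toFun (A i)) (Finset.filter_subset _ S))))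
  · exact Finset.sum_congr rfl fun i hi => abs_of_nonneg (Finset.mem_filter.1 hi).2
  · rw [← Finset.sum_neg_distrib]
    exact Finset.sum_congr rfl fun i hi => abs_of_neg (not_le.1 (Finset.mem_filter.1 hi).2)

theorem abs_simpleIntegral_le {s : X → ℝ} (hs : IsFieldSimple s) {E : Set X} {M c : ℝ}
    (hM : ∀ D ∈ closedField X, D ⊆ E → |μ.toFun D| ≤ M) (hc0 : 0 ≤ c) (hc : ∀ x, |s x| ≤ c)
    (hE : ∀ x ∉ E, s x = 0) : |μ.simpleIntegral s| ≤ c * (2 * M) := by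
  classical
  -- The value `0` is dropped, since its level set need not lie in `E`; the other level sets do.
  rw [show μ.simpleIntegral s = μ.simpleIntegral (id ∘ s) from rfl,
    μ.simpleIntegral_comp hs.1 hs.2 id,
    ← Finset.sum_filter_of_ne (p := fun r : ℝ => r ≠ 0) (fun r _ h hr => h (by simp [hr]))]
  refine (Finset.abs_sum_le_sum_abs _ _).trans ?_
  refine le_trans ?_ (mul_le_mul_of_nonneg_left (μ.sum_abs_toFun_le
    (hs.1.toFinset.filter (· ≠ 0)) (A := fun r => s ⁻¹' {r}) hM (fun r _ => hs.2 r) ?_ ?_) hc0)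
  · rw [Finset.mul_sum]
    refine Finset.sum_le_sum fun r hr => ?_
    rw [abs_mul]
    refine mul_le_mul_of_nonneg_right ?_ (abs_nonneg _)
    obtain ⟨x, rfl⟩ := hs.1.mem_toFinset.1 (Finset.mem_filter.1 hr).1
    exact hc x
  · intro r hr x hx
    by_contra hxE
    exact (Finset.mem_filter.1 hr).2 ((hE x hxE).symm.trans hx).symm
  · exact fun i _ j _ hij => Disjoint.preimage s (by simpa using hij)

theorem abs_simpleIntegral_sub_le {s t : X → ℝ} (hs : IsFieldSimple s) (ht : IsFieldSimple t)
    {M c : ℝ} (hM : ∀ D ∈ closedField X, |μ.toFun D| ≤ M) (hc0 : 0 ≤ c)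
    (hc : ∀ x, |s x - t x| ≤ c) : |μ.simpleIntegral s - μ.simpleIntegral t| ≤ c * (2 * M) := by
  rw [← μ.simpleIntegral_sub hs ht]
  exact μ.abs_simpleIntegral_le (hs.comp₂ ht fun c => c.1 - c.2) (E := Set.univ)
    (fun D hD _ => hM D hD) hc0 hc fun x hx => absurd (Set.mem_univ x) hx

theorem exists_bound : ∃ M : ℝ, 0 ≤ M ∧ ∀ A ∈ closedField X, |μ.toFun A| ≤ M := by
  obtain ⟨M, hM⟩ := μ.bounded
  exact ⟨M, (abs_nonneg _).trans (hM ∅ isSetAlgebra_closedField.empty_mem), hM⟩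

variable {μ} {f g : X → ℝ} {I J : ℝ}

theorem HasIntegral.add (hf : μ.HasIntegral f I) (hg : μ.HasIntegral g J) :
    μ.HasIntegral (fun x => f x + g x) (I + J) := by
  obtain ⟨s, hs, hsf, hsI⟩ := hf
  obtain ⟨t, ht, htg, htJ⟩ := hg
  refine ⟨fun n x => s n x + t n x, fun n => (hs n).comp₂ (ht n) fun c => c.1 + c.2,
    hsf.add htg, ?_⟩
  simp only [μ.simpleIntegral_add (hs _) (ht _)]
  exact hsI.add htJ

theorem HasIntegral.const_mul (hf : μ.HasIntegral f I) (a : ℝ) :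
    μ.HasIntegral (fun x => a * f x) (a * I) := by
  obtain ⟨s, hs, hsf, hsI⟩ := hf
  refine ⟨fun n x => a * s n x, fun n => .of_comp (hs n).1 (hs n).2 (a * ·), ?_, ?_⟩
  · exact (uniformContinuous_const_smul a).comp_tendstoUniformly hsf
  · simp only [μ.simpleIntegral_const_mul (hs _)]
    exact hsI.const_mul a

theorem HasIntegral.neg (hf : μ.HasIntegral f I) : μ.HasIntegral (fun x => -f x) (-I) := by
  simpa using hf.const_mul (-1)

theorem HasIntegral.sub (hf : μ.HasIntegral f I) (hg : μ.HasIntegral g J) :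
    μ.HasIntegral (fun x => f x - g x) (I - J) := by
  simpa [sub_eq_add_neg] using hf.add hg.neg

theorem hasIntegral_indicator_one {A : Set X} (hA : A ∈ closedField X) :
    μ.HasIntegral (A.indicator 1) (μ.toFun A) :=
  ⟨fun _ => A.indicator 1, fun _ => .indicator_one hA, fun _ hu => by
    simp [mem_uniformity_of_eq hu], by
    simp only [simpleIntegral_indicator_one]; exact tendsto_const_nhds⟩

theorem HasIntegral.sum {ι : Type*} (S : Finset ι) {f : ι → X → ℝ} {I : ι → ℝ}
    (h : ∀ i ∈ S, μ.HasIntegral (f i) (I i)) :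
    μ.HasIntegral (fun x => ∑ i ∈ S, f i x) (∑ i ∈ S, I i) := by
  classical
  induction S using Finset.induction_on with
  | empty =>
    have := hasIntegral_indicator_one (μ := μ) isSetAlgebra_closedField.empty_mem
    simpa [μ.toFun_empty, Pi.zero_def] using this
  | insert a S ha ih =>
    simp only [Finset.sum_insert ha]
    exact (h a (Finset.mem_insert_self a S)).add (ih fun i hi => h i (Finset.mem_insert_of_mem hi))

/-- A function that is bounded by `c` and vanishes off a set on which `|μ|` is at most `M` has an
integral of absolute value at most `2 c M`. -/
theorem HasIntegral.abs_le (hf : μ.HasIntegral f I) {E : Set X} (hEm : E ∈ closedField X)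
    {M c : ℝ} (hM : ∀ D ∈ closedField X, D ⊆ E → |μ.toFun D| ≤ M) (hc0 : 0 ≤ c)
    (hc : ∀ x, |f x| ≤ c) (hE : ∀ x ∉ E, f x = 0) : |I| ≤ c * (2 * M) := by
  obtain ⟨s, hs, hsf, hsI⟩ := hf
  obtain ⟨M', hM'0, hM'⟩ := μ.exists_bound
  have hM0 : 0 ≤ M := (abs_nonneg _).trans
    (hM ∅ isSetAlgebra_closedField.empty_mem (Set.empty_subset E))
  refine le_of_forall_pos_le_add fun δ hδ => ?_
  set K := 2 * M + 2 * M' + 1 with hK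
  have hK0 : 0 < K := by positivity
  rw [Metric.tendstoUniformly_iff] at hsf
  obtain ⟨n, hn, hnI⟩ := ((hsf (δ / 2 / K) (by positivity)).and
    (Metric.tendsto_nhds.1 hsI (δ / 2) (by positivity))).exists
  -- The approximants need not vanish off `E`. Multiplying by the indicator changes them only where
  -- `f = 0`, hence by at most `δ / 2 / K`.
  let e : X → ℝ := E.indicator 1
  have he : IsFieldSimple e := .indicator_one hEm
  have ht : IsFieldSimple fun x => s n x * e x := (hs n).comp₂ he fun c => c.1 * c.2
  have hn' : ∀ x, |f x - s n x| ≤ δ / 2 / K := fun x => (hn x).le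
  have h1 : |μ.simpleIntegral (s n) - μ.simpleIntegral fun x => s n x * e x| ≤
      δ / 2 / K * (2 * M') := by
    refine μ.abs_simpleIntegral_sub_le (hs n) ht hM' (by positivity) fun x => ?_
    by_cases hx : x ∈ E
    · simp only [e, Set.indicator_of_mem hx, Pi.one_apply, mul_one, sub_self, abs_zero]
      positivity
    · have := hn' x
      rw [hE x hx, zero_sub, abs_neg] at this
      simpa [e, Set.indicator_of_notMem hx] using this
  have h2 : |μ.simpleIntegral fun x => s n x * e x| ≤ (c + δ / 2 / K) * (2 * M) := by
    refine μ.abs_simpleIntegral_le ht hM (by positivity) (fun x => ?_) fun x hx => by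
      simp [e, Set.indicator_of_notMem hx]
    by_cases hx : x ∈ E
    · simp only [e, Set.indicator_of_mem hx, Pi.one_apply, mul_one]
      have h3 := hn' x
      have h4 := hc x
      rw [_root_.abs_le] at h3 h4 ⊢
      constructor <;> linarith
    · simp only [e, Set.indicator_of_notMem hx, mul_zero, abs_zero]
      positivity
  have h5 : δ / 2 / K * (2 * M + 2 * M') ≤ δ / 2 := by
    rw [div_mul_eq_mul_div, div_le_iff₀ hK0]
    nlinarith
  rw [Real.dist_eq] at hnI
  have h6 := (abs_lt.1 hnI)
  rw [_root_.abs_le] at h1 h2 ⊢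
  constructor <;> nlinarith [h1.1, h1.2, h2.1, h2.2, h6.1, h6.2]

theorem HasIntegral.abs_sub_le (hf : μ.HasIntegral f I) (hg : μ.HasIntegral g J) {M c : ℝ}
    (hM : ∀ D ∈ closedField X, |μ.toFun D| ≤ M) (hc0 : 0 ≤ c) (hc : ∀ x, |f x - g x| ≤ c) :
    |I - J| ≤ c * (2 * M) :=
  (hf.sub hg).abs_le isSetAlgebra_closedField.univ_mem (fun D hD _ => hM D hD) hc0 hc
    fun x hx => absurd (Set.mem_univ x) hx

theorem HasIntegral.unique (hf : μ.HasIntegral f I) (hg : μ.HasIntegral f J) : I = J := by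
  obtain ⟨M, -, hM⟩ := μ.exists_bound
  have := hf.abs_sub_le hg hM le_rfl (by simp)
  rw [zero_mul] at this
  exact sub_eq_zero.1 (abs_nonpos_iff.1 this)

/-- Bounded continuous functions are integrable. -/
theorem exists_hasIntegral_of_continuous (μ : RBASetFunction X) (hf : Continuous f) {C : ℝ}
    (hC : ∀ x, |f x| ≤ C) : ∃ I, μ.HasIntegral f I := by
  obtain ⟨M, hM0, hM⟩ := μ.exists_bound
  let N : ℕ → ℝ := fun n => n + 1
  have hN : ∀ n, 0 < N n := fun n => by positivity
  -- `f` is rounded down to a multiple of `1 / (n + 1)`. The level sets are half-open slices, i.e.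
  -- differences of closed sets.
  let s : ℕ → X → ℝ := fun n x => ⌊N n * f x⌋ / N n
  have hs : ∀ n, IsFieldSimple (s n) := by
    intro n
    refine .of_comp (π := fun x => ⌊N n * f x⌋) (φ := fun i => (i : ℝ) / N n) ?_ fun i => ?_
    · refine (Set.finite_Icc ⌊-(N n * C)⌋ ⌊N n * C⌋).subset ?_
      rintro _ ⟨x, rfl⟩
      have := abs_le.1 (hC x)
      refine ⟨Int.floor_le_floor ?_, Int.floor_le_floor ?_⟩ <;> nlinarith [hN n]
    · have : (fun x => ⌊N n * f x⌋) ⁻¹' {i} =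
          {x | (i : ℝ) ≤ N n * f x} \ {x | (i : ℝ) + 1 ≤ N n * f x} := by
        ext x
        simp [Int.floor_eq_iff]
      rw [this]
      have hc : Continuous fun x => N n * f x := continuous_const.mul hf
      exact isSetAlgebra_closedField.sdiff_mem
        (isClosed_le continuous_const hc).mem_closedField
        (isClosed_le continuous_const hc).mem_closedField
  have hsf : ∀ n x, |f x - s n x| ≤ 1 / N n := by
    intro n x
    have h1 := Int.floor_le (N n * f x)
    have h2 := Int.lt_floor_add_one (N n * f x)
    have h3 : f x - s n x = (N n * f x - ⌊N n * f x⌋) / N n := by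
      simp only [s]
      field_simp [(hN n).ne']
    rw [h3, abs_div, abs_of_pos (hN n), abs_of_nonneg (by linarith)]
    exact div_le_div_of_nonneg_right (by linarith) (hN n).le
  have hlim : Tendsto (fun n => 1 / N n) atTop (𝓝 0) := tendsto_one_div_add_atTop_nhds_zero_nat
  have hunif : TendstoUniformly s f atTop := by
    rw [Metric.tendstoUniformly_iff]
    intro ε hε
    filter_upwards [hlim.eventually_lt_const hε] with n hn x
    exact (hsf n x).trans_lt hn
  have hcau : CauchySeq fun n => μ.simpleIntegral (s n) := by
    refine cauchySeq_of_le_tendsto_0 (fun n => (1 / N n + 1 / N n) * (2 * M))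
      (fun n m k hn hm => ?_) ?_
    · refine μ.abs_simpleIntegral_sub_le (hs n) (hs m) hM (by positivity [hN k]) fun x => ?_
      have h1 := hsf n x
      have h2 := hsf m x
      have h3 : 1 / N n ≤ 1 / N k := one_div_le_one_div_of_le (hN k) (by simp [N, hn])
      have h4 : 1 / N m ≤ 1 / N k := one_div_le_one_div_of_le (hN k) (by simp [N, hm])
      rw [abs_le] at h1 h2 ⊢
      constructor <;> linarith
    · simpa using (hlim.add hlim).mul_const (2 * M)
  obtain ⟨I, hI⟩ := cauchySeq_tendsto_of_complete hcau
  exact ⟨I, s, hs, hunif, hI⟩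

theorem simpleIntegral_le_of_nonneg (h0 : ∀ A ∈ closedField X, 0 ≤ μ.toFun A) {s : X → ℝ}
    (hs : IsFieldSimple s) {c : ℝ} (hc : ∀ x, s x ≤ c) :
    μ.simpleIntegral s ≤ c * μ.toFun Set.univ := by
  have huniv : (Set.univ : Set X) = ⋃ r ∈ hs.1.toFinset, s ⁻¹' {r} := by
    ext x; simp
  rw [show μ.simpleIntegral s = μ.simpleIntegral (id ∘ s) from rfl,
    μ.simpleIntegral_comp hs.1 hs.2 id, huniv, μ.toFun_biUnion _ (fun r _ => hs.2 r)
    fun i _ j _ hij => Disjoint.preimage s (by simpa using hij), Finset.mul_sum]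
  refine Finset.sum_le_sum fun r hr => mul_le_mul_of_nonneg_right ?_ (h0 _ (hs.2 r))
  obtain ⟨x, rfl⟩ := hs.1.mem_toFinset.1 hr
  exact hc x

theorem HasIntegral.nonpos (h0 : ∀ A ∈ closedField X, 0 ≤ μ.toFun A) (hf : μ.HasIntegral f I)
    (hf0 : ∀ x, f x ≤ 0) : I ≤ 0 := by
  obtain ⟨s, hs, hsf, hsI⟩ := hf
  have hm : 0 ≤ μ.toFun Set.univ := h0 _ isSetAlgebra_closedField.univ_mem
  refine le_of_forall_pos_le_add fun δ hδ => ?_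
  rw [Metric.tendstoUniformly_iff] at hsf
  refine le_of_tendsto hsI ?_
  filter_upwards [hsf (δ / (μ.toFun Set.univ + 1)) (by positivity)] with n hn
  refine (simpleIntegral_le_of_nonneg h0 (hs n) (c := δ / (μ.toFun Set.univ + 1))
    fun x => ?_).trans ?_
  · have h1 := hn x
    rw [Real.dist_eq, abs_lt] at h1
    linarith [hf0 x]
  · rw [zero_add, div_mul_eq_mul_div, div_le_iff₀ (by positivity)]
    nlinarith

/-- The integral with respect to a nonnegative set function is monotone. -/
theorem HasIntegral.mono (h0 : ∀ A ∈ closedField X, 0 ≤ μ.toFun A) (hf : μ.HasIntegral f I)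
    (hg : μ.HasIntegral g J) (hfg : ∀ x, f x ≤ g x) : I ≤ J :=
  sub_nonpos.1 ((hf.sub hg).nonpos h0 fun x => sub_nonpos.2 (hfg x))

end RBASetFunction

end FieldIntegral

/-! ### The dual of `C_b(X)` for normal `X` -/

section DualCb

variable {X : Type*} [TopologicalSpace X]

/-- In a normal space, a closed set covered by two open sets is a union of closed subsets of
them. -/
theorem IsClosed.exists_union_of_subset_union [NormalSpace X] {K U V : Set X} (hK : IsClosed K)
    (hU : IsOpen U) (hV : IsOpen V) (h : K ⊆ U ∪ V) :
    ∃ A B, IsClosed A ∧ IsClosed B ∧ A ⊆ U ∧ B ⊆ V ∧ A ∪ B = K := by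
  -- These disjoint closed sets have disjoint open neighbourhoods `S` and `T`; removing each from
  -- `K` gives the two pieces.
  have hd : Disjoint (K \ U) (K \ V) := by
    rw [Set.disjoint_left]
    rintro x ⟨hx, hxU⟩ ⟨-, hxV⟩
    exact (h hx).elim hxU hxV
  obtain ⟨S, T, hS, hT, hKS, hKT, hST⟩ :=
    normal_separation (hK.sdiff hU) (hK.sdiff hV) hd
  refine ⟨K \ S, K \ T, hK.sdiff hS, hK.sdiff hT, fun x hx => ?_, fun x hx => ?_, ?_⟩
  · by_contra hxU
    exact hx.2 (hKS ⟨hx.1, hxU⟩)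
  · by_contra hxV
    exact hx.2 (hKT ⟨hx.1, hxV⟩)
  · rw [← Set.sdiff_inter, hST.inter_eq, Set.sdiff_empty]

namespace PositiveLinearMap

variable (P : (X →ᵇ ℝ) →ₚ[ℝ] ℝ)

/-- The infimum of `P g` over the bounded continuous functions `g` that dominate the indicator
function of `F`. -/
def closedContent (F : Set X) : ℝ := sInf (P '' {g | 0 ≤ g ∧ ∀ x ∈ F, 1 ≤ g x})

variable {P} {F G : Set X}

theorem closedContent_le {g : X →ᵇ ℝ} (h0 : 0 ≤ g) (h : ∀ x ∈ F, 1 ≤ g x) :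
    P.closedContent F ≤ P g :=
  csInf_le ⟨0, by rintro _ ⟨g, hg, rfl⟩; exact P.map_nonneg hg.1⟩ ⟨g, ⟨h0, h⟩, rfl⟩

theorem one_mem_dominating : (1 : X →ᵇ ℝ) ∈ {g : X →ᵇ ℝ | 0 ≤ g ∧ ∀ x ∈ F, 1 ≤ g x} :=
  ⟨fun _ => zero_le_one, fun _ _ => le_rfl⟩

theorem le_closedContent {c : ℝ} (h : ∀ g : X →ᵇ ℝ, 0 ≤ g → (∀ x ∈ F, 1 ≤ g x) → c ≤ P g) :
    c ≤ P.closedContent F :=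
  le_csInf ⟨_, 1, one_mem_dominating, rfl⟩ (by rintro _ ⟨g, hg, rfl⟩; exact h g hg.1 hg.2)

theorem exists_lt_closedContent_add (F : Set X) {ε : ℝ} (hε : 0 < ε) :
    ∃ g : X →ᵇ ℝ, 0 ≤ g ∧ (∀ x ∈ F, 1 ≤ g x) ∧ P g < P.closedContent F + ε := by
  obtain ⟨_, ⟨g, hg, rfl⟩, hlt⟩ := exists_lt_of_csInf_lt
    (⟨_, 1, one_mem_dominating, rfl⟩ : (P '' {g | 0 ≤ g ∧ ∀ x ∈ F, 1 ≤ g x}).Nonempty)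
    (lt_add_of_pos_right (P.closedContent F) hε)
  exact ⟨g, hg.1, hg.2, hlt⟩

theorem closedContent_nonneg (F : Set X) : 0 ≤ P.closedContent F :=
  le_closedContent fun _ h0 _ => P.map_nonneg h0

theorem closedContent_empty : P.closedContent (∅ : Set X) = 0 :=
  le_antisymm (by simpa using closedContent_le (P := P) (F := ∅) (g := 0) le_rfl (by simp))
    (closedContent_nonneg _)

theorem closedContent_mono (h : F ⊆ G) : P.closedContent F ≤ P.closedContent G :=
  le_closedContent fun _ h0 h1 => closedContent_le h0 fun x hx => h1 x (h hx)

theorem closedContent_le_one (F : Set X) : P.closedContent F ≤ P 1 :=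
  closedContent_le (fun _ => zero_le_one) fun _ _ => le_rfl

theorem closedContent_univ : P.closedContent (Set.univ : Set X) = P 1 :=
  le_antisymm (closedContent_le_one _)
    (le_closedContent fun _ _ h => OrderHomClass.mono P fun x => h x trivial)

/-- If `u` dominates the indicator of `F`, then `c • u` dominates `g`. This bounds `P` on each layer
of a function. -/
theorem le_closedContent_of_le {g : X →ᵇ ℝ} {c : ℝ} (hc : 0 < c) (h1 : ∀ x, g x ≤ c)
    (hF : ∀ x ∉ F, g x ≤ 0) : P g ≤ c * P.closedContent F := by
  rw [← div_le_iff₀' hc]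
  refine le_closedContent fun u h0 hu => ?_
  rw [div_le_iff₀' hc, ← smul_eq_mul, ← map_smul]
  refine OrderHomClass.mono P fun x => ?_
  change g x ≤ c * u x
  by_cases hx : x ∈ F
  · nlinarith [h1 x, hu x hx]
  · exact (hF x hx).trans (mul_nonneg hc.le (h0 x))

theorem closedContent_union_le (F G : Set X) :
    P.closedContent (F ∪ G) ≤ P.closedContent F + P.closedContent G := by
  rw [← sub_le_iff_le_add]
  refine le_closedContent fun g g0 hg => ?_
  rw [sub_le_comm]
  refine le_closedContent fun h h0 hh => ?_
  rw [sub_le_iff_le_add', ← map_add]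
  refine closedContent_le (add_nonneg g0 h0) fun x hx => ?_
  have h1 : 0 ≤ g x := g0 x
  have h2 : 0 ≤ h x := h0 x
  rw [BoundedContinuousFunction.add_apply]
  rcases hx with hx | hx
  · linarith [hg x hx]
  · linarith [hh x hx]

/-- A Urysohn function `u`, `1` on `F` and `0` on `G`, splits a function `g` dominating the union
into `g * u`, dominating on `F`, and `g - g * u`, dominating on `G`. -/
theorem closedContent_union_of_disjoint [NormalSpace X] (hF : IsClosed F) (hG : IsClosed G)
    (hd : Disjoint F G) :
    P.closedContent F + P.closedContent G ≤ P.closedContent (F ∪ G) := by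
  refine le_closedContent fun g g0 hg => ?_
  obtain ⟨u, hu0, hu1, hu⟩ := exists_continuous_zero_one_of_isClosed hG hF hd.symm
  let v : X →ᵇ ℝ := .ofNormedAddCommGroup u u.continuous 1 fun x => by
    rw [Real.norm_eq_abs, abs_of_nonneg (hu x).1]; exact (hu x).2
  have hv : ∀ x, v x = u x := fun x => rfl
  have h1 : P.closedContent F ≤ P (g * v) := by
    refine closedContent_le (fun x => mul_nonneg (g0 x) (hu x).1) fun x hx => ?_
    rw [BoundedContinuousFunction.mul_apply, hv, hu1 hx, Pi.one_apply, mul_one]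
    exact hg x (Or.inl hx)
  have h2 : P.closedContent G ≤ P (g - g * v) := by
    refine closedContent_le (fun x => ?_) fun x hx => ?_
    · change 0 ≤ g x - g x * u x
      nlinarith [(hu x).2, show 0 ≤ g x from g0 x]
    · rw [BoundedContinuousFunction.sub_apply, BoundedContinuousFunction.mul_apply, hv, hu0 hx,
        Pi.zero_apply, mul_zero, sub_zero]
      exact hg x (Or.inr hx)
  rw [map_sub] at h2
  linarith

/-- Outer regularity of `closedContent`. -/
theorem exists_isOpen_closedContent_le (F : Set X) {ε : ℝ} (hε : 0 < ε) :
    ∃ U, IsOpen U ∧ F ⊆ U ∧ ∀ G ⊆ U, P.closedContent G ≤ P.closedContent F + ε := by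
  obtain ⟨g, g0, hg, hlt⟩ := exists_lt_closedContent_add (P := P) F (half_pos hε)
  have hP1 : 0 ≤ P 1 := P.map_nonneg fun _ => zero_le_one
  -- Adding the constant `δ` costs at most `δ * P 1 ≤ ε / 2`, and makes the set where the function
  -- exceeds `1` an open neighbourhood of `F`.
  set δ := ε / 2 / (P 1 + 1) with hδ
  have hδ0 : 0 < δ := by positivity
  refine ⟨{x | 1 < g x + δ}, isOpen_lt continuous_const (g.continuous.add continuous_const),
    fun x hx => ?_, fun G hG => ?_⟩
  · rw [Set.mem_ofPred_eq]
    linarith [hg x hx]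
  · refine (closedContent_le (g := g + δ • 1) ?_ fun x hx => ?_).trans ?_
    · exact add_nonneg g0 fun x => mul_nonneg hδ0.le zero_le_one
    · have : 1 < g x + δ := hG hx
      simpa using this.le
    · rw [map_add, map_smul, smul_eq_mul]
      have : δ * P 1 ≤ ε / 2 := by
        rw [hδ, div_mul_eq_mul_div, div_le_iff₀ (by positivity)]
        nlinarith
      linarith

variable (P) in
/-- The inner set function induced by `closedContent`. -/
def innerContent (A : Set X) : ℝ := sSup (P.closedContent '' {F | IsClosed F ∧ F ⊆ A})

variable {A B : Set X}

theorem le_innerContent (hF : IsClosed F) (h : F ⊆ A) : P.closedContent F ≤ P.innerContent A :=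
  le_csSup ⟨P 1, by rintro _ ⟨F, -, rfl⟩; exact closedContent_le_one F⟩ ⟨F, ⟨hF, h⟩, rfl⟩

theorem innerContent_le {c : ℝ} (h : ∀ F, IsClosed F → F ⊆ A → P.closedContent F ≤ c) :
    P.innerContent A ≤ c :=
  csSup_le ⟨_, ∅, ⟨isClosed_empty, Set.empty_subset A⟩, rfl⟩
    (by rintro _ ⟨F, hF, rfl⟩; exact h F hF.1 hF.2)

theorem exists_lt_innerContent (A : Set X) {ε : ℝ} (hε : 0 < ε) :
    ∃ F, IsClosed F ∧ F ⊆ A ∧ P.innerContent A - ε < P.closedContent F := by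
  obtain ⟨_, ⟨F, hF, rfl⟩, hlt⟩ := exists_lt_of_lt_csSup
    (⟨_, ∅, ⟨isClosed_empty, Set.empty_subset A⟩, rfl⟩ :
      (P.closedContent '' {F | IsClosed F ∧ F ⊆ A}).Nonempty)
    (sub_lt_self (P.innerContent A) hε)
  exact ⟨F, hF.1, hF.2, hlt⟩

theorem innerContent_nonneg (A : Set X) : 0 ≤ P.innerContent A :=
  closedContent_empty.symm.le.trans (le_innerContent isClosed_empty (Set.empty_subset A))

theorem innerContent_of_isClosed (hF : IsClosed F) : P.innerContent F = P.closedContent F :=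
  le_antisymm (innerContent_le fun _ _ h => closedContent_mono h) (le_innerContent hF subset_rfl)

theorem innerContent_le_one (A : Set X) : P.innerContent A ≤ P 1 :=
  innerContent_le fun F _ _ => closedContent_le_one F

theorem innerContent_univ : P.innerContent (Set.univ : Set X) = P 1 := by
  rw [innerContent_of_isClosed isClosed_univ, closedContent_univ]

theorem map_const (c : ℝ) : P (BoundedContinuousFunction.const X c) = c * P 1 := by
  rw [← smul_eq_mul, ← map_smul]
  congr 1
  ext x
  simp

variable [NormalSpace X]

theorem add_innerContent_le (hd : Disjoint A B) :
    P.innerContent A + P.innerContent B ≤ P.innerContent (A ∪ B) := by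
  rw [← le_sub_iff_add_le]
  refine innerContent_le fun F hF hFA => ?_
  rw [le_sub_comm]
  refine innerContent_le fun G hG hGB => ?_
  rw [le_sub_iff_add_le']
  exact (closedContent_union_of_disjoint hF hG (hd.mono hFA hGB)).trans
    (le_innerContent (hF.union hG) (Set.union_subset_union hFA hGB))

/-- The members of the closed field satisfy Carathéodory's criterion for the inner content. -/
theorem innerContent_inter_add_sdiff (hA : A ∈ closedField X) (T : Set X) :
    P.innerContent (T ∩ A) + P.innerContent (T \ A) = P.innerContent T := by
  suffices closedField X ⊆ {A | ∀ T, P.innerContent (T ∩ A) + P.innerContent (T \ A) =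
      P.innerContent T} from this hA T
  -- The sets satisfying the criterion form an algebra, so only closed sets `C` need a topological
  -- argument.
  refine IsSetAlgebra.generateSetAlgebra_subset (fun C hC T => ?_) ⟨fun T => ?_, fun A hA T => ?_,
    fun A B hA hB T => ?_⟩
  · refine le_antisymm ?_ (innerContent_le fun K hK hKT => ?_)
    · refine (add_innerContent_le (Set.disjoint_sdiff_right.mono_left
        Set.inter_subset_right)).trans_eq ?_
      rw [Set.inter_union_sdiff]
    · refine le_of_forall_pos_le_add fun ε hε => ?_
      -- A closed `K ⊆ T` is covered by `U ⊇ K ∩ C` and `Cᶜ`. Normality cuts it into closed pieces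
      -- `L ⊆ U` and `M ⊆ Cᶜ`, and outer regularity bounds the content of `L` by that of `K ∩ C`
      -- plus `ε`.
      obtain ⟨U, hU, hKU, hle⟩ := exists_isOpen_closedContent_le (P := P) (K ∩ C) hε
      obtain ⟨L, M, hL, hM, hLU, hMC, hLM⟩ := hK.exists_union_of_subset_union hU
        (show IsOpen Cᶜ from IsClosed.isOpen_compl (self := hC)) fun x hx => by
          by_cases hxC : x ∈ C
          · exact Or.inl (hKU ⟨hx, hxC⟩)
          · exact Or.inr hxC
      have h1 := closedContent_union_le (P := P) L M
      rw [hLM] at h1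
      have h2 := hle L hLU
      have h3 : P.closedContent (K ∩ C) ≤ P.innerContent (T ∩ C) :=
        le_innerContent (hK.inter hC) (Set.inter_subset_inter_left C hKT)
      have h4 : P.closedContent M ≤ P.innerContent (T \ C) :=
        le_innerContent hM fun x hx => ⟨hKT (hLM ▸ Or.inr hx), hMC hx⟩
      linarith
  · simp [innerContent_of_isClosed isClosed_empty, closedContent_empty]
  · rw [Set.sdiff_compl, ← Set.sdiff_eq, add_comm]
    exact hA T
  · have h1 := hA (T ∩ (A ∪ B))
    have h2 := hB (T \ A)
    rw [Set.inter_assoc, Set.inter_eq_right.2 Set.subset_union_left] at h1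
    rw [← hA T, ← h1, ← h2, Set.sdiff_sdiff]
    have : (T ∩ (A ∪ B)) \ A = (T \ A) ∩ B := by
      ext x
      simp only [Set.mem_sdiff, Set.mem_inter_iff, Set.mem_union]
      tauto
    rw [this, add_assoc]

theorem innerContent_union (hA : A ∈ closedField X) (hd : Disjoint A B) :
    P.innerContent (A ∪ B) = P.innerContent A + P.innerContent B := by
  rw [← innerContent_inter_add_sdiff hA (A ∪ B), Set.union_inter_cancel_left,
    Set.union_sdiff_cancel_left (Set.disjoint_iff.1 hd)]

variable (P) in
open scoped Classical in
/-- The regular set function representing a positive functional on `C_b(X)`. -/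
def toRBASetFunction : RBASetFunction X where
  toAddContent := IsSetRing.addContent_of_union
    (fun A => if A ∈ closedField X then P.innerContent A else 0)
    isSetAlgebra_closedField.isSetRing
    (by simp [innerContent_of_isClosed isClosed_empty, closedContent_empty])
    (fun {s t} hs ht hd => by
      rw [if_pos hs, if_pos ht, if_pos (isSetAlgebra_closedField.union_mem hs ht)]
      exact innerContent_union hs hd)
  eq_zero_of_notMem A hA := if_neg hA
  bounded := ⟨P 1, fun A hA => by
    change |if A ∈ closedField X then P.innerContent A else 0| ≤ P 1
    rw [if_pos hA, abs_of_nonneg (innerContent_nonneg A)]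
    exact innerContent_le_one A⟩
  regular A hA ε hε := by
    -- `F` and `G` fill `A` and `Aᶜ` up to `ε / 2` each. A set `D ⊆ Gᶜ \ F` is disjoint from `F ∪
    -- G`, so less than `ε` of the total content `P 1` remains for it.
    obtain ⟨F, hF, hFA, hFε⟩ := exists_lt_innerContent (P := P) A (half_pos hε)
    obtain ⟨G, hG, hGA, hGε⟩ := exists_lt_innerContent (P := P) Aᶜ (half_pos hε)
    refine ⟨F, hF.mem_closedField, Gᶜ, hG.isOpen_compl.mem_closedField, hF.closure_eq.symm ▸ hFA,
      by rw [hG.isOpen_compl.interior_eq]; exact Set.subset_compl_comm.1 hGA, fun D hD hDG => ?_⟩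
    change |if D ∈ closedField X then P.innerContent D else 0| < ε
    rw [if_pos hD, abs_of_nonneg (innerContent_nonneg D)]
    have h1 := innerContent_inter_add_sdiff (P := P) hA Set.univ
    rw [Set.univ_inter, ← Set.compl_eq_univ_sdiff] at h1
    have hFG : Disjoint F G := Set.disjoint_left.2 fun x hxF hxG => hGA hxG (hFA hxF)
    have h2 := add_innerContent_le (P := P) hFG
    have h3 := add_innerContent_le (P := P) (A := D) (B := F ∪ G)
      (Set.disjoint_left.2 fun x hxD hx => hx.elim (hDG hxD).2 (hDG hxD).1)
    have h4 := innerContent_le_one (P := P) (D ∪ (F ∪ G))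
    rw [innerContent_univ] at h1
    rw [innerContent_of_isClosed hF, innerContent_of_isClosed hG] at h2
    linarith

theorem toRBASetFunction_toFun (hA : A ∈ closedField X) :
    P.toRBASetFunction.toFun A = P.innerContent A := by
  classical
  exact if_pos hA

theorem toRBASetFunction_nonneg (A : Set X) (hA : A ∈ closedField X) :
    0 ≤ P.toRBASetFunction.toFun A := by
  rw [toRBASetFunction_toFun hA]
  exact innerContent_nonneg A

/-- Cut `f` into horizontal layers of height `δ`. The layer starting at height `i * δ` is at most
`δ` and is nonpositive off `E i = {i * δ ≤ f}`, so `P f ≤ ∑ δ * μ (E i)`. Since `∑ δ * 1_{E i} ≤ f +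
δ`, this is at most `J + δ * P 1`. -/
theorem le_of_hasIntegral_of_nonneg {f : X →ᵇ ℝ} (hf : 0 ≤ f) {J : ℝ}
    (hJ : P.toRBASetFunction.HasIntegral f J) : P f ≤ J := by
  have hP1 : 0 ≤ P 1 := P.map_nonneg fun _ => zero_le_one
  refine le_of_forall_pos_le_add fun ε hε => ?_
  set δ := ε / (P 1 + 1) with hδ
  have hδ0 : 0 < δ := by positivity
  obtain ⟨n, hn⟩ := exists_nat_ge (‖f‖ / δ)
  rw [div_le_iff₀ hδ0] at hn
  let E : ℕ → Set X := fun i => {x | i * δ ≤ f x}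
  have hE : ∀ i, IsClosed (E i) := fun i => isClosed_le continuous_const f.continuous
  let u : ℕ → X →ᵇ ℝ := fun i => f ⊓ .const X (i * δ)
  have hu : ∀ i x, u i x = min (f x) (i * δ) := fun i x => rfl
  have hsum : ∑ i ∈ Finset.range n, (u (i + 1) - u i) = f := by
    rw [Finset.sum_range_sub]
    ext x
    have h1 : 0 ≤ f x := hf x
    have h2 : f x ≤ n * δ := ((le_abs_self _).trans (f.norm_coe_le_norm x)).trans hn
    simp [hu, h1, h2]
  have hle : P f ≤ ∑ i ∈ Finset.range n, δ * P.toRBASetFunction.toFun (E i) := by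
    conv_lhs => rw [← hsum]
    rw [map_sum]
    refine Finset.sum_le_sum fun i _ => ?_
    rw [toRBASetFunction_toFun (hE i).mem_closedField, innerContent_of_isClosed (hE i)]
    refine le_closedContent_of_le hδ0 (fun x => ?_) fun x hx => ?_
    · rw [BoundedContinuousFunction.sub_apply, hu, hu]
      push_cast
      rcases min_cases (f x) ((i + 1) * δ) with h | h <;>
        rcases min_cases (f x) (i * δ) with h' | h' <;> nlinarith
    · rw [BoundedContinuousFunction.sub_apply, hu, hu]
      have : f x < i * δ := not_le.1 hx
      rw [min_eq_left this.le, sub_nonpos]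
      exact min_le_left _ _
  have hI : P.toRBASetFunction.HasIntegral
      (fun x => ∑ i ∈ Finset.range n, δ * (E i).indicator 1 x)
      (∑ i ∈ Finset.range n, δ * P.toRBASetFunction.toFun (E i)) :=
    .sum _ fun i _ => (RBASetFunction.hasIntegral_indicator_one (hE i).mem_closedField).const_mul δ
  have hI' : P.toRBASetFunction.HasIntegral (fun x => f x + δ * (Set.univ : Set X).indicator 1 x)
      (J + δ * P.toRBASetFunction.toFun Set.univ) :=
    hJ.add ((RBASetFunction.hasIntegral_indicator_one
      isSetAlgebra_closedField.univ_mem).const_mul δ)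
  have hmono := hI.mono toRBASetFunction_nonneg hI' fun x => by
    -- Raising `f` by `δ` fills its layer over `E i` completely, and the layers telescope.
    have h1 : ∀ i ∈ Finset.range n, δ * (E i).indicator 1 x ≤
        min (f x + δ) ((i + 1 : ℕ) * δ) - min (f x + δ) (i * δ) := by
      intro i _
      push_cast
      by_cases hx : x ∈ E i
      · have hx' : i * δ ≤ f x := hx
        rw [Set.indicator_of_mem hx, Pi.one_apply, min_eq_right (by linarith),
          min_eq_right (by linarith)]
        linarith
      · rw [Set.indicator_of_notMem hx, mul_zero, sub_nonneg]
        exact min_le_min le_rfl (by linarith)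
    refine (Finset.sum_le_sum h1).trans ?_
    rw [Finset.sum_range_sub fun i : ℕ => min (f x + δ) (i * δ)]
    have h2 : 0 ≤ f x := hf x
    simp only [Nat.cast_zero, zero_mul, Set.mem_univ, Set.indicator_of_mem, Pi.one_apply, mul_one]
    rw [min_eq_right (show (0 : ℝ) ≤ f x + δ by linarith), sub_zero]
    exact min_le_left _ _
  rw [toRBASetFunction_toFun isSetAlgebra_closedField.univ_mem, innerContent_univ] at hmono
  have h5 : δ * P 1 ≤ ε := by
    rw [hδ, div_mul_eq_mul_div, div_le_iff₀ (by positivity)]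
    nlinarith
  linarith

/-- Adding the constant `‖f‖` reduces to nonnegative functions; constants are integrated exactly
because the whole space has content `P 1`. -/
theorem le_of_hasIntegral {f : X →ᵇ ℝ} {J : ℝ}
    (hJ : P.toRBASetFunction.HasIntegral f J) : P f ≤ J := by
  have h1 := hJ.add ((RBASetFunction.hasIntegral_indicator_one (μ := P.toRBASetFunction)
    (isSetAlgebra_closedField (X := X)).univ_mem).const_mul ‖f‖)
  have h2 := le_of_hasIntegral_of_nonneg (P := P) (f := f + .const X ‖f‖) (fun x => by
    change 0 ≤ f x + ‖f‖
    linarith [neg_le_of_abs_le (f.norm_coe_le_norm x)]) (by simpa [Pi.add_def] using h1)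
  rw [map_add, map_const, toRBASetFunction_toFun isSetAlgebra_closedField.univ_mem,
    innerContent_univ] at h2
  linarith

/-- A positive functional on `C_b(X)` is integration with respect to a regular set function. -/
theorem hasIntegral_toRBASetFunction (P : (X →ᵇ ℝ) →ₚ[ℝ] ℝ) (f : X →ᵇ ℝ) :
    P.toRBASetFunction.HasIntegral f (P f) := by
  obtain ⟨J, hJ⟩ := P.toRBASetFunction.exists_hasIntegral_of_continuous f.continuous
    f.norm_coe_le_norm
  have h1 := le_of_hasIntegral hJ
  -- The one-sided estimate for `-f` gives the reverse inequality.
  have h2 := le_of_hasIntegral (f := -f) hJ.neg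
  rw [map_neg, neg_le_neg_iff] at h2
  rwa [le_antisymm h1 h2]

end PositiveLinearMap

/-- A continuous linear functional on `C_b(X)` is the difference of the integrals with respect to
two regular set functions. -/
theorem BoundedContinuousFunction.exists_rba_dual [NormalSpace X] (Λ : (X →ᵇ ℝ) →L[ℝ] ℝ) :
    ∃ p n : RBASetFunction X, ∀ f : X →ᵇ ℝ, ∃ I J,
      p.HasIntegral f I ∧ n.HasIntegral f J ∧ Λ f = I - J := by
  have hmono : PosSMulMono ℝ (X →ᵇ ℝ) :=
    ⟨fun c hc f g hfg x => mul_le_mul_of_nonneg_left (hfg x) hc⟩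
  have hbdd : ∀ f : X →ᵇ ℝ, BddAbove (Λ.toLinearMap '' Set.Icc 0 f) := by
    intro f
    refine ⟨‖Λ‖ * ‖f‖, ?_⟩
    rintro _ ⟨g, hg, rfl⟩
    refine (le_abs_self _).trans ((Λ.le_opNorm g).trans
      (mul_le_mul_of_nonneg_left ?_ (norm_nonneg _)))
    rw [BoundedContinuousFunction.norm_le (norm_nonneg f)]
    intro x
    rw [Real.norm_eq_abs, abs_of_nonneg (show 0 ≤ g x from hg.1 x)]
    exact (hg.2 x).trans ((le_abs_self _).trans (f.norm_coe_le_norm x))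
  obtain ⟨P, N, hPN, -⟩ := Λ.toLinearMap.exists_positive_sub hbdd
  exact ⟨P.toRBASetFunction, N.toRBASetFunction, fun f => ⟨P f, N f,
    P.hasIntegral_toRBASetFunction f, N.hasIntegral_toRBASetFunction f, hPN f⟩⟩

/-! ### Regular set functions are determined by their integrals. -/

namespace RBASetFunction

theorem ext_of_toFun {μ ν : RBASetFunction X} (h : ∀ A ∈ closedField X, μ.toFun A = ν.toFun A) :
    μ = ν := by
  have hfun : μ.toFun = ν.toFun := by
    ext A
    by_cases hA : A ∈ closedField X
    · exact h A hA
    · rw [μ.eq_zero_of_notMem A hA, ν.eq_zero_of_notMem A hA]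
  obtain ⟨⟨a, _, _⟩, _, _, _⟩ := μ
  obtain ⟨⟨b, _, _⟩, _, _, _⟩ := ν
  obtain rfl : a = b := hfun
  rfl

theorem toFun_sdiff (μ : RBASetFunction X) {A B : Set X} (hA : A ∈ closedField X)
    (hB : B ∈ closedField X) (h : B ⊆ A) : μ.toFun (A \ B) = μ.toFun A - μ.toFun B := by
  have hd := isSetAlgebra_closedField.sdiff_mem hA hB
  have := addContent_union' (m := μ.toAddContent) hB hd
    (isSetAlgebra_closedField.union_mem hB hd) Set.disjoint_sdiff_right
  rw [Set.union_sdiff_cancel h] at this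
  have : μ.toFun A = μ.toFun B + μ.toFun (A \ B) := this
  linarith

/-- Set functions which agree on closed sets are equal, by regularity. -/
theorem ext_of_isClosed {μ ν : RBASetFunction X}
    (h : ∀ F, IsClosed F → μ.toFun F = ν.toFun F) : μ = ν := by
  refine ext_of_toFun fun A hA => ?_
  rw [← sub_eq_zero, ← abs_nonpos_iff]
  refine le_of_forall_pos_le_add fun ε hε => ?_
  obtain ⟨B, -, C, -, hBA, hAC, hB⟩ := μ.regular A hA (ε / 2) (half_pos hε)
  obtain ⟨B', -, C', -, hBA', hAC', hB'⟩ := ν.regular A hA (ε / 2) (half_pos hε)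
  -- This closed subset of `A` serves both set functions: `A \ F` lies in `C \ B` and in `C' \ B'`,
  -- so both are smaller than `ε / 2` on it.
  set F := closure B ∪ closure B'
  have hF : IsClosed F := isClosed_closure.union isClosed_closure
  have hFA : F ⊆ A := Set.union_subset hBA hBA'
  have hm := isSetAlgebra_closedField.sdiff_mem hA hF.mem_closedField
  have h1 := hB (A \ F) hm fun x hx => ⟨interior_subset (hAC hx.1),
    fun hxB => hx.2 (Or.inl (subset_closure hxB))⟩
  have h2 := hB' (A \ F) hm fun x hx => ⟨interior_subset (hAC' hx.1),
    fun hxB => hx.2 (Or.inr (subset_closure hxB))⟩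
  rw [toFun_sdiff _ hA hF.mem_closedField hFA, abs_lt] at h1 h2
  rw [abs_le]
  have := h F hF
  constructor <;> linarith

/-- Regular set functions with the same integrals of bounded continuous functions are equal. -/
theorem ext_of_hasIntegral [NormalSpace X] {μ ν : RBASetFunction X}
    (h : ∀ (g : X →ᵇ ℝ) I J, μ.HasIntegral g I → ν.HasIntegral g J → I = J) : μ = ν := by
  refine ext_of_isClosed fun F hF => ?_
  rw [← sub_eq_zero, ← abs_nonpos_iff]
  refine le_of_forall_pos_le_add fun ε hε => ?_
  obtain ⟨B, -, C, -, hBF, hFC, hB⟩ := μ.regular F hF.mem_closedField (ε / 4) (by positivity)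
  obtain ⟨B', -, C', -, hBF', hFC', hB'⟩ := ν.regular F hF.mem_closedField (ε / 4) (by positivity)
  -- A Urysohn function for `F` inside `U` differs from the indicator of `F` only on `U \ F`, where
  -- both set functions are small. Each integral is then within `2 * (ε / 4)` of the value on `F`.
  set U := interior C ∩ interior C'
  have hU : IsOpen U := isOpen_interior.inter isOpen_interior
  have hFU : F ⊆ U := Set.subset_inter hFC hFC'
  obtain ⟨u, hu0, hu1, hu⟩ := exists_continuous_zero_one_of_isClosed hU.isClosed_compl hF
    (Set.disjoint_left.2 fun x hxU hxF => hxU (hFU hxF))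
  let g : X →ᵇ ℝ := .ofNormedAddCommGroup u u.continuous 1 fun x => by
    rw [Real.norm_eq_abs, abs_of_nonneg (hu x).1]; exact (hu x).2
  obtain ⟨I, hI⟩ := μ.exists_hasIntegral_of_continuous g.continuous g.norm_coe_le_norm
  obtain ⟨J, hJ⟩ := ν.exists_hasIntegral_of_continuous g.continuous g.norm_coe_le_norm
  have hm := isSetAlgebra_closedField.sdiff_mem hU.mem_closedField hF.mem_closedField
  have hle : ∀ x, |g x - F.indicator 1 x| ≤ 1 := by
    intro x
    change |u x - F.indicator 1 x| ≤ 1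
    by_cases hx : x ∈ F
    · simp [hx, hu1 hx]
    · simp [hx, abs_of_nonneg (hu x).1, (hu x).2]
  have hzero : ∀ x ∉ U \ F, g x - F.indicator 1 x = 0 := by
    intro x hx
    change u x - F.indicator 1 x = 0
    by_cases hxF : x ∈ F
    · simp [hxF, hu1 hxF]
    · have : x ∈ Uᶜ := fun hxU => hx ⟨hxU, hxF⟩
      simp [hxF, hu0 this]
  have h1 := (hI.sub (hasIntegral_indicator_one hF.mem_closedField)).abs_le hm (M := ε / 4)
    (fun D hD hDE => (hB D hD fun x hx => ⟨interior_subset (hDE hx).1.1,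
      fun hxB => (hDE hx).2 (hBF (subset_closure hxB))⟩).le) zero_le_one hle hzero
  have h2 := (hJ.sub (hasIntegral_indicator_one hF.mem_closedField)).abs_le hm (M := ε / 4)
    (fun D hD hDE => (hB' D hD fun x hx => ⟨interior_subset (hDE hx).1.2,
      fun hxB => (hDE hx).2 (hBF' (subset_closure hxB))⟩).le) zero_le_one hle hzero
  have h3 := h g I J hI hJ
  rw [_root_.abs_le] at h1 h2 ⊢
  constructor <;> linarith [h1.1, h1.2, h2.1, h2.2]

end RBASetFunction

end DualCb

/-! ### Functions in a reproducing kernel Hilbert space -/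

namespace RKHS

section Kernel

variable {X H : Type*} [NormedAddCommGroup H] [InnerProductSpace ℝ H] [CompleteSpace H]
  [RKHS ℝ H X ℝ] {k : X → X → ℝ}

theorem inner_kerFun_one (f : H) (x : X) : ⟪f, kerFun H x (1 : ℝ)⟫ = f x := by
  simp

namespace IsReproducingKernel

theorem kerFun_apply (hk : IsReproducingKernel H k) (x y : X) : kerFun H y (1 : ℝ) x = k x y := by
  rw [RKHS.kerFun_apply]; exact hk x y

theorem symm (hk : IsReproducingKernel H k) (x y : X) : k x y = k y x := by
  rw [← hk.kerFun_apply, ← hk.kerFun_apply y x, ← inner_kerFun_one, ← inner_kerFun_one,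
    real_inner_comm]

theorem norm_sq_kerFun (hk : IsReproducingKernel H k) (x : X) : ‖kerFun H x (1 : ℝ)‖ ^ 2 = k x x := by
  rw [← real_inner_self_eq_norm_sq, inner_kerFun_one, hk.kerFun_apply]

/-- Cauchy–Schwarz with `‖k(·, x)‖ ^ 2 = k x x`. Norm convergence in `H` is therefore uniform
convergence. -/
theorem abs_apply_le (hk : IsReproducingKernel H k) {C : ℝ} (hC : ∀ x y, |k x y| ≤ C) (f : H)
    (x : X) : |f x| ≤ √C * ‖f‖ := by
  rw [← inner_kerFun_one f x, mul_comm]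
  refine (abs_real_inner_le_norm _ _).trans (mul_le_mul_of_nonneg_left ?_ (norm_nonneg f))
  refine Real.le_sqrt_of_sq_le ?_
  rw [hk.norm_sq_kerFun]
  exact (le_abs_self _).trans (hC x x)

/-- The kernel embedding exists if integration is a continuous linear functional on the Hilbert
space. -/
theorem exists_isKernelEmbedding (hk : IsReproducingKernel H k) {M : Type*}
    {hasInt : M → (X → ℝ) → ℝ → Prop}
    (h : ∀ μ, ∃ ℓ : H →L[ℝ] ℝ, ∀ f : H, hasInt μ (fun x => f x) (ℓ f)) :
    ∃ Φ : M → H, IsKernelEmbedding k hasInt Φ := by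
  choose ℓ hℓ using h
  have hΦ : ∀ μ (f : H), ⟪f, (InnerProductSpace.toDual ℝ H).symm (ℓ μ)⟫ = ℓ μ f := fun μ f => by
    rw [real_inner_comm, InnerProductSpace.toDual_symm_apply]
  refine ⟨fun μ => (InnerProductSpace.toDual ℝ H).symm (ℓ μ), fun μ y => ?_, fun μ f => ?_⟩
  -- Evaluation at `y` is pairing with `k(·, y)`, which equals `k(y, ·)` by symmetry.
  · rw [← inner_kerFun_one, real_inner_comm, hΦ]
    have := hℓ μ (kerFun H y (1 : ℝ))
    simp only [hk.kerFun_apply] at this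
    simpa only [hk.symm y] using this
  · rw [hΦ]
    exact hℓ μ f

variable [TopologicalSpace X]

/-- The elements of a reproducing kernel Hilbert space with continuous kernel are continuous. -/
theorem continuous_apply (hk : IsReproducingKernel H k)
    (hc : Continuous fun p : X × X => k p.1 p.2) (f : H) : Continuous fun x => f x := by
  -- The feature map is continuous since its squared increments are `k y y - 2 * k y x + k x x`.
  have hker : Continuous fun x => kerFun H x (1 : ℝ) := by
    refine continuous_iff_continuousAt.2 fun x => ?_
    rw [ContinuousAt, tendsto_iff_norm_sub_tendsto_zero]
    have h1 : ∀ y, ‖kerFun H y (1 : ℝ) - kerFun H x (1 : ℝ)‖ = √(k y y - 2 * k y x + k x x) := by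
      intro y
      rw [← hk.norm_sq_kerFun y, ← hk.norm_sq_kerFun x, ← hk.kerFun_apply y x,
        ← inner_kerFun_one, real_inner_comm, ← norm_sub_sq_real, Real.sqrt_sq (norm_nonneg _)]
    simp only [h1]
    have h2 : Continuous fun y => √(k y y - 2 * k y x + k x x) := by
      have h3 : Continuous fun y => k y y := hc.comp (continuous_id.prodMk continuous_id)
      have h4 : Continuous fun y => k y x := hc.comp (continuous_id.prodMk continuous_const)
      fun_prop
    have h5 := h2.tendsto x
    rwa [show k x x - 2 * k x x + k x x = 0 by ring, Real.sqrt_zero] at h5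
  simp only [← inner_kerFun_one]
  exact continuous_const.inner hker

/-- The elements of a reproducing kernel Hilbert space are in `C₀(X)` if the kernel is bounded and
its sections are in `C₀(X)`. -/
theorem continuous_tendsto_zero (hk : IsReproducingKernel H k) {C : ℝ}
    (hC : ∀ x y, |k x y| ≤ C)
    (h0 : ∀ x, Continuous (fun y => k y x) ∧ Tendsto (fun y => k y x) (cocompact X) (𝓝 0)) (f : H) :
    Continuous (fun x => f x) ∧ Tendsto (fun x => f x) (cocompact X) (𝓝 0) := by
  have hspan : ∀ g ∈ Submodule.span ℝ {kerFun H x v | (x : X) (v : ℝ)},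
      Continuous (fun x => g x) ∧ Tendsto (fun x => g x) (cocompact X) (𝓝 0) := by
    intro g hg
    induction hg using Submodule.span_induction with
    | mem g hg =>
      obtain ⟨x, v, rfl⟩ := hg
      have : ∀ y, kerFun H x v y = v * k y x := fun y => by
        rw [← hk.kerFun_apply y x, ← smul_eq_mul, ← Pi.smul_apply, ← RKHS.coe_smul, ← map_smul,
          smul_eq_mul, mul_one]
      simp only [this]
      exact ⟨continuous_const.mul (h0 x).1, by simpa using (h0 x).2.const_mul v⟩
    | zero => simpa using ⟨continuous_const, tendsto_const_nhds⟩
    | add g h _ _ hg hh =>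
      simp only [RKHS.coe_add, Pi.add_apply]
      exact ⟨hg.1.add hh.1, by simpa using hg.2.add hh.2⟩
    | smul a g _ hg =>
      simp only [RKHS.coe_smul, Pi.smul_apply, smul_eq_mul]
      exact ⟨continuous_const.mul hg.1, by simpa using hg.2.const_mul a⟩
  -- The span of the kernel sections is dense in `H`, hence approximates uniformly, and both
  -- properties survive uniform limits.
  have happ : ∀ ε > 0, ∃ g ∈ Submodule.span ℝ {kerFun H x v | (x : X) (v : ℝ)},
      ∀ x, |f x - g x| < ε := by
    intro ε hε
    have hf : f ∈ closure (Submodule.span ℝ {kerFun H x v | (x : X) (v : ℝ)} : Set H) := by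
      rw [← Submodule.topologicalClosure_coe, kerFun_dense]
      trivial
    obtain ⟨g, hg, hlt⟩ := Metric.mem_closure_iff.1 hf (ε / (√C + 1)) (by positivity)
    refine ⟨g, hg, fun x => ?_⟩
    rw [← Pi.sub_apply, ← RKHS.coe_sub]
    refine (hk.abs_apply_le hC _ x).trans_lt ?_
    rw [dist_eq_norm, lt_div_iff₀ (by positivity)] at hlt
    nlinarith [norm_nonneg (f - g)]
  constructor
  · refine continuous_of_uniform_approx_of_continuous fun u hu => ?_
    obtain ⟨ε, hε, hεu⟩ := Metric.mem_uniformity_dist.1 hu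
    obtain ⟨g, hg, hlt⟩ := happ ε hε
    exact ⟨fun x => g x, (hspan g hg).1, fun x => hεu (hlt x)⟩
  · rw [Metric.tendsto_nhds]
    intro ε hε
    obtain ⟨g, hg, hlt⟩ := happ (ε / 2) (half_pos hε)
    filter_upwards [Metric.tendsto_nhds.1 (hspan g hg).2 (ε / 2) (half_pos hε)] with x hx
    have := hlt x
    rw [Real.dist_eq, sub_zero, abs_lt] at *
    constructor <;> linarith

end IsReproducingKernel

end Kernel

/-- A linear map into a normed space has dense range unless a nonzero continuous functional vanishes
on its range. -/
theorem exists_norm_sub_le_of_forall_dual {H E : Type*} [AddCommGroup H] [Module ℝ H]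
    [NormedAddCommGroup E] [NormedSpace ℝ E] (T : H →ₗ[ℝ] E)
    (h : ∀ Λ : E →L[ℝ] ℝ, (∀ f, Λ (T f) = 0) → Λ = 0) (g : E) {ε : ℝ} (hε : 0 < ε) :
    ∃ f, ‖T f - g‖ ≤ ε := by
  have hmem : g ∈ closure (LinearMap.range T : Set E) := by
    by_contra hg
    rw [← Submodule.topologicalClosure_coe] at hg
    obtain ⟨Λ, u, hΛ, hu⟩ := geometric_hahn_banach_closed_point
      (Submodule.convex (LinearMap.range T).topologicalClosure)
      (LinearMap.range T).isClosed_topologicalClosure hg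
    have hbd : ∀ f, Λ (T f) < u := fun f => hΛ _ (subset_closure ⟨f, rfl⟩)
    have hu0 : 0 < u := by simpa using hbd 0
    have hΛ0 : Λ = 0 := h Λ fun f => by
      by_contra hne
      -- A functional bounded above by `u` on a subspace vanishes there: otherwise this multiple
      -- would attain the value `u`.
      have := hbd ((u / Λ (T f)) • f)
      rw [map_smul, map_smul, smul_eq_mul, div_mul_cancel₀ _ hne] at this
      exact this.false
    rw [hΛ0] at hu
    exact absurd (hu0.trans hu) (by simp)
  obtain ⟨_, ⟨f, rfl⟩, hf⟩ := Metric.mem_closure_iff.1 hmem ε hε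
  exact ⟨f, by rw [← dist_eq_norm, dist_comm]; exact hf.le⟩

/-! ### Integration as a bounded functional on the Hilbert space. -/

section Embedding

variable {X H : Type*} [TopologicalSpace X] [NormedAddCommGroup H] [InnerProductSpace ℝ H]
  [RKHS ℝ H X ℝ] {k : X → X → ℝ}

theorem exists_clm_hasIntegral_signed [MeasurableSpace X] [BorelSpace X]
    (hc : ∀ f : H, Continuous fun x => f x) {C : ℝ} (hC : ∀ (f : H) x, |f x| ≤ C * ‖f‖)
    (μ : SignedRadonMeasure X) :
    ∃ ℓ : H →L[ℝ] ℝ, ∀ f : H, μ.HasIntegral (fun x => f x) (ℓ f) := by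
  have hi : ∀ f : H, μ.1.Integrable (fun x => f x) := fun f =>
    μ.1.integrable_of_continuous_of_abs_le (hc f) (hC f)
  let L : H →ₗ[ℝ] ℝ :=
    { toFun := fun f => ∫ᵛ x, f x ∂•μ.1
      map_add' := fun f g => by
        simp only [RKHS.coe_add, Pi.add_apply]
        exact VectorMeasure.integral_fun_add (hi f) (hi g)
      map_smul' := fun a f => by
        simp only [RKHS.coe_smul, Pi.smul_apply]
        exact VectorMeasure.integral_fun_smul _ _ a _ }
  refine ⟨L.mkContinuous (C * μ.1.totalVariation.real Set.univ) fun f => ?_, fun f => ⟨hi f, rfl⟩⟩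
  have := SignedMeasure.abs_integral_sub_le (hi f) (g := fun _ => 0) (ε := C * ‖f‖)
    (by simp [VectorMeasure.Integrable]) (by simpa using ae_of_all _ (hC f))
  rw [VectorMeasure.integral_zero, sub_zero] at this
  refine this.trans_eq ?_
  ring

theorem exists_clm_hasIntegral_rba
    (hc : ∀ f : H, Continuous fun x => f x) {C : ℝ} (hC0 : 0 ≤ C)
    (hC : ∀ (f : H) x, |f x| ≤ C * ‖f‖)
    (μ : RBASetFunction X) :
    ∃ ℓ : H →L[ℝ] ℝ, ∀ f : H, μ.HasIntegral (fun x => f x) (ℓ f) := by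
  choose I hI using fun f : H => μ.exists_hasIntegral_of_continuous (hc f) (hC f)
  obtain ⟨M, hM0, hM⟩ := μ.exists_bound
  let L : H →ₗ[ℝ] ℝ :=
    { toFun := I
      map_add' := fun f g => (hI (f + g)).unique (by simpa using! (hI f).add (hI g))
      map_smul' := fun a f => (hI (a • f)).unique (by simpa using! (hI f).const_mul a) }
  refine ⟨L.mkContinuous (C * (2 * M)) fun f => ?_, hI⟩
  have := (hI f).abs_le isSetAlgebra_closedField.univ_mem (fun D hD _ => hM D hD)
    (by positivity) (hC f) fun x hx => absurd (Set.mem_univ x) hx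
  refine this.trans_eq ?_
  ring

end Embedding

end RKHS

/-! ### Universality and injectivity of the kernel embedding -/

theorem MeasureTheory.Measure.totalVariation_toSignedMeasure {X : Type*} [MeasurableSpace X]
    (m : Measure X) [IsFiniteMeasure m] : m.toSignedMeasure.totalVariation = m := by
  rw [SignedMeasure.totalVariation_eq_variation, Measure.variation_toSignedMeasure]

/-! ### Positive Radon measures inside `M_b(X)` and `M_bc(X)`. -/

section RadonOfMeasure

variable {X : Type*} [TopologicalSpace X] [MeasurableSpace X]

/-- A finite positive Radon measure, as a signed Radon measure. -/
def SignedRadonMeasure.ofMeasure (m : Measure X) [IsFiniteMeasure m] [h : m.InnerRegular] :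
    SignedRadonMeasure X :=
  ⟨m.toSignedMeasure, by rwa [m.totalVariation_toSignedMeasure]⟩

theorem SignedRadonMeasure.HasIntegral.ofMeasure_eq {m : Measure X} [IsFiniteMeasure m]
    [m.InnerRegular] {f : X → ℝ} {I : ℝ} (h : (ofMeasure m).HasIntegral f I) :
    I = ∫ x, f x ∂m :=
  h.2.symm.trans (m.integral_toSignedMeasure_real f)

theorem SignedRadonMeasure.totalVariation_ofMeasure (m : Measure X) [IsFiniteMeasure m]
    [m.InnerRegular] : (ofMeasure m).1.totalVariation = m :=
  m.totalVariation_toSignedMeasure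

theorem SignedRadonMeasure.ofMeasure_injective {m n : Measure X} [IsFiniteMeasure m]
    [IsFiniteMeasure n] [m.InnerRegular] [n.InnerRegular] (h : ofMeasure m = ofMeasure n) :
    m = n := by
  have h1 := congrArg (fun μ : SignedRadonMeasure X => μ.1.totalVariation) h
  exact (totalVariation_ofMeasure m).symm.trans (h1.trans (totalVariation_ofMeasure n))

/-- A finite positive Radon measure with compact support, as a signed one. -/
def CompactSignedRadonMeasure.ofMeasure (m : Measure X) [IsFiniteMeasure m] [m.InnerRegular]
    (hm : IsCompact m.support) : CompactSignedRadonMeasure X :=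
  ⟨.ofMeasure m, by rwa [SignedRadonMeasure.totalVariation_ofMeasure]⟩

theorem CompactSignedRadonMeasure.HasIntegral.ofMeasure_eq {m : Measure X} [IsFiniteMeasure m]
    [m.InnerRegular] {hm : IsCompact m.support} {f : X → ℝ} {I : ℝ}
    (h : (ofMeasure m hm).HasIntegral f I) : I = ∫ x, f x ∂m :=
  SignedRadonMeasure.HasIntegral.ofMeasure_eq h

theorem CompactSignedRadonMeasure.ofMeasure_injective {m n : Measure X} [IsFiniteMeasure m]
    [IsFiniteMeasure n] [m.InnerRegular] [n.InnerRegular] {hm : IsCompact m.support}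
    {hn : IsCompact n.support} (h : ofMeasure m hm = ofMeasure n hn) : m = n :=
  SignedRadonMeasure.ofMeasure_injective (congrArg Subtype.val h)

/-- Functionals on `C(Z)`, `Z ⊆ X` compact, are represented by measures on `X` with compact
support. -/
theorem IsCompact.exists_measure_dual [BorelSpace X] [T2Space X] {Z : Set X} (hZ : IsCompact Z)
    (Λ : C₀(Z, ℝ) →L[ℝ] ℝ) :
    ∃ p n : Measure X, IsFiniteMeasure p ∧ IsFiniteMeasure n ∧ p.InnerRegular ∧ n.InnerRegular ∧
      IsCompact p.support ∧ IsCompact n.support ∧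
      (∀ (g : C₀(Z, ℝ)) (f : X → ℝ), (∀ z : Z, g z = f z) → Λ g = ∫ x, f x ∂p - ∫ x, f x ∂n) ∧
      (p = n → Λ = 0) := by
  have hZc : CompactSpace Z := isCompact_iff_compactSpace.1 hZ
  have hZm : MeasurableEmbedding ((↑) : Z → X) := .subtype_coe hZ.measurableSet
  have hsupp : ∀ m : Measure Z, IsCompact (m.map ((↑) : Z → X)).support := by
    intro m
    refine hZ.of_isClosed_subset Measure.isClosed_support
      (Measure.support_subset_of_isClosed hZ.isClosed ?_)
    rw [mem_ae_iff, hZm.map_apply]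
    simp
  have hreg : ∀ m : Measure Z, [m.InnerRegular] → (m.map ((↑) : Z → X)).InnerRegular := fun m _ =>
    Measure.InnerRegular.map_of_continuous continuous_subtype_val
  obtain ⟨p, n, _, _, _, _, hpn⟩ := ZeroAtInftyContinuousMap.exists_measure_dual Λ
  -- The representing measures on `Z` are pushed forward along the inclusion; `comap` undoes this,
  -- so equality on `X` gives equality on `Z`.
  refine ⟨p.map (↑), n.map (↑), inferInstance, inferInstance, hreg p, hreg n, hsupp p, hsupp n,
    fun g f hgf => ?_, fun hmap => ?_⟩
  · rw [hpn, hZm.integral_map, hZm.integral_map]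
    simp only [hgf]
  · have : p = n := (hZm.comap_map p).symm.trans
      ((congrArg (Measure.comap _) hmap).trans (hZm.comap_map n))
    subst this
    ext g
    rw [hpn, sub_self, zero_apply]

end RadonOfMeasure

namespace RKHS

variable {X H : Type*} [TopologicalSpace X] [NormedAddCommGroup H] [InnerProductSpace ℝ H]
  [RKHS ℝ H X ℝ] {k : X → X → ℝ}

theorem isCUniversal_iff_isC0Universal [CompactSpace X] : IsCUniversal H ↔ IsC0Universal H := by
  refine ⟨fun h g => h g.toContinuousMap, fun h g => h ⟨g, ?_⟩⟩
  rw [cocompact_eq_bot]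
  exact tendsto_bot

section Radon

variable [MeasurableSpace X] [BorelSpace X] [T2Space X] [LocallyCompactSpace X]

theorem isC0Universal_iff_injective (hf : ∀ f : H, Continuous (fun x => f x) ∧
    Tendsto (fun x => f x) (cocompact X) (𝓝 0)) {Φ : SignedRadonMeasure X → H}
    (hΦ : IsKernelEmbedding k SignedRadonMeasure.HasIntegral Φ) :
    IsC0Universal H ↔ Function.Injective Φ := by
  constructor
  · intro hU μ ν hμν
    refine Subtype.ext (SignedMeasure.ext_of_forall_exists_approx μ.2 ν.2 fun g ε hε => ?_)
    obtain ⟨f, hfg⟩ := hU (g : C₀(X, ℝ)) ε hε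
    have h1 := hΦ.2 μ f
    have h2 := hΦ.2 ν f
    rw [← hμν] at h2
    exact ⟨fun x => f x, h1.1, h2.1, h1.2.trans h2.2.symm, ae_of_all _ hfg, ae_of_all _ hfg⟩
  · intro hinj
    let T : H →ₗ[ℝ] C₀(X, ℝ) :=
      { toFun := fun f => ⟨⟨fun x => f x, (hf f).1⟩, (hf f).2⟩
        map_add' := fun f g => by ext x; simp
        map_smul' := fun a f => by ext x; simp }
    have hT : ∀ f x, T f x = f x := fun f x => rfl
    have hdual : ∀ Λ : C₀(X, ℝ) →L[ℝ] ℝ, (∀ f, Λ (T f) = 0) → Λ = 0 := by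
      intro Λ hΛ
      obtain ⟨p, n, _, _, _, _, hpn⟩ := ZeroAtInftyContinuousMap.exists_measure_dual Λ
      -- Vanishing of `Λ` on `H` says that the two embeddings have the same inner product with every
      -- `f`.
      have heq : Φ (.ofMeasure p) = Φ (.ofMeasure n) := by
        refine ext_inner_left ℝ fun f => ?_
        rw [(hΦ.2 _ f).ofMeasure_eq, (hΦ.2 _ f).ofMeasure_eq, ← sub_eq_zero]
        exact (hpn (T f)).symm.trans (hΛ f)
      obtain rfl := SignedRadonMeasure.ofMeasure_injective (hinj heq)
      ext g
      rw [hpn, sub_self, zero_apply]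
    intro g ε hε
    obtain ⟨f, hfg⟩ := exists_norm_sub_le_of_forall_dual T hdual g hε
    exact ⟨f, fun x => ((T f - g).toBCF.norm_coe_le_norm x).trans hfg⟩

theorem isCCUniversal_iff_injective (hf : ∀ f : H, Continuous fun x => f x)
    {Φ : CompactSignedRadonMeasure X → H}
    (hΦ : IsKernelEmbedding k CompactSignedRadonMeasure.HasIntegral Φ) :
    IsCCUniversal H ↔ Function.Injective Φ := by
  constructor
  · intro hU μ ν hμν
    refine Subtype.ext (Subtype.ext
      (SignedMeasure.ext_of_forall_exists_approx μ.1.2 ν.1.2 fun g ε hε => ?_))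
    -- The union of the two supports is compact, and inner regularity makes the complement of each
    -- support null for its measure, so closeness there suffices.
    obtain ⟨f, hfg⟩ := hU (μ.1.1.totalVariation.support ∪ ν.1.1.totalVariation.support)
      (μ.2.union ν.2) ⟨fun z => g z, by fun_prop⟩ ε hε
    have h1 := hΦ.2 μ f
    have h2 := hΦ.2 ν f
    rw [← hμν] at h2
    have hμr := μ.1.2
    have hνr := ν.1.2
    refine ⟨fun x => f x, h1.1, h2.1, h1.2.trans h2.2.symm, ?_, ?_⟩
    · filter_upwards [Measure.support_mem_ae_of_innerRegular (μ := μ.1.1.totalVariation)] with x hx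
      exact hfg ⟨x, Or.inl hx⟩
    · filter_upwards [Measure.support_mem_ae_of_innerRegular (μ := ν.1.1.totalVariation)] with x hx
      exact hfg ⟨x, Or.inr hx⟩
  · intro hinj Z hZ
    have hZc : CompactSpace Z := isCompact_iff_compactSpace.1 hZ
    have hZv : Continuous ((↑) : Z → X) := continuous_subtype_val
    -- On a compact `Z` vanishing at infinity is no condition, so `C₀(Z)` is all of `C(Z)`.
    have htends : ∀ g : Z → ℝ, Tendsto g (cocompact Z) (𝓝 0) := fun g => by
      rw [cocompact_eq_bot]; exact tendsto_bot
    let T : H →ₗ[ℝ] C₀(Z, ℝ) :=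
      { toFun := fun f => ⟨⟨fun z => f z, (hf f).comp hZv⟩, htends _⟩
        map_add' := fun f g => by ext x; simp
        map_smul' := fun a f => by ext x; simp }
    have hT : ∀ f z, T f z = f z := fun f x => rfl
    have hdual : ∀ Λ : C₀(Z, ℝ) →L[ℝ] ℝ, (∀ f, Λ (T f) = 0) → Λ = 0 := by
      intro Λ hΛ
      obtain ⟨p, n, _, _, _, _, hp, hn, hpn, hΛ0⟩ := hZ.exists_measure_dual Λ
      refine hΛ0 (CompactSignedRadonMeasure.ofMeasure_injective (hm := hp) (hn := hn)
        (hinj (ext_inner_left ℝ fun f => ?_)))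
      rw [(hΦ.2 _ f).ofMeasure_eq, (hΦ.2 _ f).ofMeasure_eq, ← sub_eq_zero]
      exact (hpn (T f) (fun x => f x) (hT f)).symm.trans (hΛ f)
    intro g ε hε
    obtain ⟨g', hg'⟩ : ∃ g' : C₀(Z, ℝ), ∀ z, g' z = g z := ⟨⟨g, htends g⟩, fun z => rfl⟩
    obtain ⟨f, hfg⟩ := exists_norm_sub_le_of_forall_dual T hdual g' hε
    refine ⟨f, fun z => ?_⟩
    rw [← hg']
    exact ((T f - g').toBCF.norm_coe_le_norm z).trans hfg

end Radon

theorem isCbUniversal_iff_injective [NormalSpace X] (hf : ∀ f : H, Continuous fun x => f x)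
    {C : ℝ} (hC : ∀ (f : H) x, |f x| ≤ C * ‖f‖) {Φ : RBASetFunction X → H}
    (hΦ : IsKernelEmbedding k RBASetFunction.HasIntegral Φ) :
    IsCbUniversal H ↔ Function.Injective Φ := by
  constructor
  · intro hU μ ν hμν
    refine RBASetFunction.ext_of_hasIntegral fun g I J hI hJ => ?_
    obtain ⟨M, hM0, hM⟩ := μ.exists_bound
    obtain ⟨M', hM'0, hM'⟩ := ν.exists_bound
    rw [← sub_eq_zero, ← abs_nonpos_iff]
    refine le_of_forall_pos_le_add fun δ hδ => ?_
    set K := 2 * M + 2 * M' + 1 with hK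
    have hK0 : 0 < K := by positivity
    obtain ⟨f, hfg⟩ := hU g (δ / K) (by positivity)
    have h1 := (hΦ.2 μ f).abs_sub_le hI hM (by positivity) hfg
    have h2 := (hΦ.2 ν f).abs_sub_le hJ hM' (by positivity) hfg
    rw [← hμν] at h2
    have h3 : δ / K * (2 * M + 2 * M') ≤ δ := by
      rw [div_mul_eq_mul_div, div_le_iff₀ hK0]
      nlinarith
    rw [mul_add] at h3
    rw [abs_le] at h1 h2 ⊢
    constructor <;> linarith [h1.1, h1.2, h2.1, h2.2]
  · intro hinj
    let T : H →ₗ[ℝ] (X →ᵇ ℝ) :=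
      { toFun := fun f => .ofNormedAddCommGroup (fun x => f x) (hf f) (C * ‖f‖) (hC f)
        map_add' := fun f g => by ext x; simp
        map_smul' := fun a f => by ext x; simp }
    have hdual : ∀ Λ : (X →ᵇ ℝ) →L[ℝ] ℝ, (∀ f, Λ (T f) = 0) → Λ = 0 := by
      intro Λ hΛ
      obtain ⟨p, n, hpn⟩ := BoundedContinuousFunction.exists_rba_dual Λ
      have heq : Φ p = Φ n := by
        refine ext_inner_left ℝ fun f => ?_
        obtain ⟨I, J, hI, hJ, hIJ⟩ := hpn (T f)
        rw [(hΦ.2 p f).unique hI, (hΦ.2 n f).unique hJ, ← sub_eq_zero]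
        exact hIJ.symm.trans (hΛ f)
      obtain rfl := hinj heq
      ext g
      obtain ⟨I, J, hI, hJ, hIJ⟩ := hpn g
      rw [hIJ, hI.unique hJ, sub_self, zero_apply]
    intro g ε hε
    obtain ⟨f, hfg⟩ := exists_norm_sub_le_of_forall_dual T hdual g hε
    exact ⟨f, fun x => ((T f - g).norm_coe_le_norm x).trans hfg⟩

end RKHS

end

theorem mainTheorem1 {X : Type*} [TopologicalSpace X] [MeasurableSpace X] [BorelSpace X]
    {H : Type*} [NormedAddCommGroup H] [InnerProductSpace ℝ H] [CompleteSpace H] [RKHS ℝ H X ℝ]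
    (k : X → X → ℝ) (hk : RKHS.IsReproducingKernel H k) :
    (∀ [CompactSpace X] [T2Space X], Continuous (fun p : X × X => k p.1 p.2) →
      ∃ Φ : SignedRadonMeasure X → H,
        IsKernelEmbedding k SignedRadonMeasure.HasIntegral Φ ∧
        (RKHS.IsCUniversal H ↔ Function.Injective Φ)) ∧
    (∀ [LocallyCompactSpace X] [T2Space X], Continuous (fun p : X × X => k p.1 p.2) →
      (∃ C : ℝ, ∀ x y, |k x y| ≤ C) →
      ∃ Φ : CompactSignedRadonMeasure X → H,
        IsKernelEmbedding k CompactSignedRadonMeasure.HasIntegral Φ ∧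
        (RKHS.IsCCUniversal H ↔ Function.Injective Φ)) ∧
    (∀ [LocallyCompactSpace X] [T2Space X], (∃ C : ℝ, ∀ x y, |k x y| ≤ C) →
      (∀ x, Continuous (fun y => k y x) ∧ Tendsto (fun y => k y x) (cocompact X) (𝓝 0)) →
      ∃ Φ : SignedRadonMeasure X → H,
        IsKernelEmbedding k SignedRadonMeasure.HasIntegral Φ ∧
        (RKHS.IsC0Universal H ↔ Function.Injective Φ)) ∧
    (∀ [NormalSpace X], Continuous (fun p : X × X => k p.1 p.2) →
      (∃ C : ℝ, ∀ x y, |k x y| ≤ C) →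
      ∃ Φ : RBASetFunction X → H,
        IsKernelEmbedding k RBASetFunction.HasIntegral Φ ∧
        (RKHS.IsCbUniversal H ↔ Function.Injective Φ)) := by
  refine ⟨fun {_ _} hc => ?_, fun {_ _} hc ⟨C, hC⟩ => ?_, fun {_ _} ⟨C, hC⟩ h0 => ?_,
    fun {_} hc ⟨C, hC⟩ => ?_⟩
  -- On a compact space the kernel is automatically bounded, and c-universality coincides with
  -- c₀-universality.
  · obtain ⟨C, hC⟩ := isCompact_univ.exists_bound_of_continuousOn
      (f := fun p : X × X => k p.1 p.2) hc.continuousOn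
    have hC' : ∀ x y, |k x y| ≤ C := fun x y => hC (x, y) trivial
    have hf := hk.continuous_apply hc
    obtain ⟨Φ, hΦ⟩ := hk.exists_isKernelEmbedding
      (RKHS.exists_clm_hasIntegral_signed hf (hk.abs_apply_le hC'))
    refine ⟨Φ, hΦ, RKHS.isCUniversal_iff_isC0Universal.trans
      (RKHS.isC0Universal_iff_injective (fun f => ⟨hf f, ?_⟩) hΦ)⟩
    rw [cocompact_eq_bot]
    exact tendsto_bot
  · have hf := hk.continuous_apply hc
    obtain ⟨Φ, hΦ⟩ := hk.exists_isKernelEmbedding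
      (hasInt := CompactSignedRadonMeasure.HasIntegral)
      fun μ => RKHS.exists_clm_hasIntegral_signed hf (hk.abs_apply_le hC) μ.1
    exact ⟨Φ, hΦ, RKHS.isCCUniversal_iff_injective hf hΦ⟩
  · have hf := hk.continuous_tendsto_zero hC h0
    obtain ⟨Φ, hΦ⟩ := hk.exists_isKernelEmbedding
      (RKHS.exists_clm_hasIntegral_signed (fun f => (hf f).1) (hk.abs_apply_le hC))
    exact ⟨Φ, hΦ, RKHS.isC0Universal_iff_injective hf hΦ⟩
  · have hf := hk.continuous_apply hc
    obtain ⟨Φ, hΦ⟩ := hk.exists_isKernelEmbedding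
      (RKHS.exists_clm_hasIntegral_rba hf (Real.sqrt_nonneg C) (hk.abs_apply_le hC))
    exact ⟨Φ, hΦ, RKHS.isCbUniversal_iff_injective hf (hk.abs_apply_le hC) hΦ⟩
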